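/- Let $m\ge 1$ and let $D_0,D_1$ be real $m\times m$ matrices with nonnegative entries. For a finite binary word $z=z_0z_1\cdots z_{k-1}$ of length $\ell(z)=k$ write $D_z=D_{z_0}D_{z_1}\cdots D_{z_{k-1}}$ (the identity matrix if $z$ is empty), and assume that $D_z\neq 0$ for every $z$. Let $q\ge 1$ be an integer and $Q$ an invertible real $m\times m$ matrix such that $Q^{-1}D_0^qQ$ is the matrix whose $(0,0)$ entry is $1$ and all of whose other entries are $0$ (so that $\operatorname{rank}(D_0^q)=1$; rows and columns are numbered from $0$). Put $D'_0=Q^{-1}D_0Q$, $D'_1=Q^{-1}D_1Q$, define $D'_z$ in the same way as $D_z$, and let $D'_z(0,0)$ be its upper left corner entry. Let $\chi(0^q)$ be the set of finite binary words that contain no $q$ consecutive zeros and whose rightmost digit is $1$, together with the empty word. Let $\|\cdot\|$ be any norm on the real $m\times m$ matrices, and let $z_0,z_1,\dots$ be independent fair coin tosses with values in $\{0,1\}$. Then the series in $$\lambda=\frac1{2^{q+1}(2^q-1)}\sum_{z\in\chi(0^q)}\frac{1}{2^{\ell(z)}}\ln|D'_z(0,0)|,\qquad \kappa=\frac1{2^{q+1}(2^q-1)}\sum_{z\in\chi(0^q)}\frac{q+\ell(z)}{2^{\ell(z)}}\ln|D'_z(0,0)|,$$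 $$\mu=\frac1{2^{q+1}(2^q-1)}\sum_{z\in\chi(0^q)}\frac{1}{2^{\ell(z)}}\bigl(\ln|D'_z(0,0)|\bigr)^2$$ converge absolutely. The generalized Lyapunov exponent $$L(t)=\lim_{k\to\infty}\frac1k\ln \mathbb E\bigl(\|D_{z_0}D_{z_1}\cdots D_{z_{k-1}}\|^t\bigr)$$ exists as a finite limit for every real $t$, is differentiable in a neighbourhood of $0$ and twice differentiable at $0$, and it satisfies $L'(0)=\lambda$ and $$\sigma^2:=L''(0)=\left(1+2\,\frac{2^{2q+1}-(3+q)2^q+1}{2^q-1}\right)\lambda^2-2\lambda\kappa+\mu .$$ -/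

import Mathlib

open Filter Topology

noncomputable section

/-- The product `D_z = D_{z_0} D_{z_1} ⋯ D_{z_{k-1}}` for a finite binary word `z`
(the identity matrix for the empty word). -/
def wordProd {m : ℕ} (D : Fin 2 → Matrix (Fin m) (Fin m) ℝ) (z : List (Fin 2)) :
    Matrix (Fin m) (Fin m) ℝ :=
  (z.map D).prod

/-- `E (‖D_{z_0} ⋯ D_{z_{k-1}}‖ ^ t)` for `k` independent fair coin tosses, that is, the average
over the `2 ^ k` binary words of length `k`; the norm is `N`. -/
def normMoment {m : ℕ} (N : Seminorm ℝ (Matrix (Fin m) (Fin m) ℝ))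
    (D : Fin 2 → Matrix (Fin m) (Fin m) ℝ) (t : ℝ) (k : ℕ) : ℝ :=
  (∑ z : Fin k → Fin 2, N (wordProd D (List.ofFn z)) ^ t) / 2 ^ k

/-- `L` is the generalized (moment) Lyapunov exponent: for every real `t` the limit of
`(1 / k) ln E (‖D_{z_0} ⋯ D_{z_{k-1}}‖ ^ t)` exists and equals `L t`. -/
def IsMomentLyapunovExponent {m : ℕ} (N : Seminorm ℝ (Matrix (Fin m) (Fin m) ℝ))
    (D : Fin 2 → Matrix (Fin m) (Fin m) ℝ) (L : ℝ → ℝ) : Prop :=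
  ∀ t : ℝ, Tendsto (fun k : ℕ => 1 / (k : ℝ) * Real.log (normMoment N D t k)) atTop (𝓝 (L t))

/-- The finite binary words without a block of `q` consecutive zeros whose last digit, if there
is one, is `1`. The empty word belongs to the set. -/
def chi (q : ℕ) : Set (List (Fin 2)) :=
  {z | ¬ List.replicate q 0 <:+: z ∧ ∀ a ∈ z.getLast?, a = 1}

/-- The matrices `Q⁻¹ D_0 Q` and `Q⁻¹ D_1 Q`. -/
def conjMat {m : ℕ} (Q : Matrix (Fin m) (Fin m) ℝ) (D : Fin 2 → Matrix (Fin m) (Fin m) ℝ) :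
    Fin 2 → Matrix (Fin m) (Fin m) ℝ :=
  fun a => Q⁻¹ * D a * Q

/-- `ln |D'_z(0,0)|`, where `D'_a = Q⁻¹ D_a Q`. -/
def logCorner {m : ℕ} [NeZero m] (Q : Matrix (Fin m) (Fin m) ℝ)
    (D : Fin 2 → Matrix (Fin m) (Fin m) ℝ) (z : List (Fin 2)) : ℝ :=
  Real.log |wordProd (conjMat Q D) z 0 0|

def lamTerm {m : ℕ} [NeZero m] (Q : Matrix (Fin m) (Fin m) ℝ)
    (D : Fin 2 → Matrix (Fin m) (Fin m) ℝ) (z : List (Fin 2)) : ℝ :=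
  1 / 2 ^ z.length * logCorner Q D z

def kappaTerm {m : ℕ} [NeZero m] (Q : Matrix (Fin m) (Fin m) ℝ)
    (D : Fin 2 → Matrix (Fin m) (Fin m) ℝ) (q : ℕ) (z : List (Fin 2)) : ℝ :=
  ((q : ℝ) + z.length) / 2 ^ z.length * logCorner Q D z

def muTerm {m : ℕ} [NeZero m] (Q : Matrix (Fin m) (Fin m) ℝ)
    (D : Fin 2 → Matrix (Fin m) (Fin m) ℝ) (z : List (Fin 2)) : ℝ :=
  1 / 2 ^ z.length * logCorner Q D z ^ 2

def lam {m : ℕ} [NeZero m] (Q : Matrix (Fin m) (Fin m) ℝ)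
    (D : Fin 2 → Matrix (Fin m) (Fin m) ℝ) (q : ℕ) : ℝ :=
  1 / (2 ^ (q + 1) * (2 ^ q - 1)) * ∑' z : chi q, lamTerm Q D z

def kappa {m : ℕ} [NeZero m] (Q : Matrix (Fin m) (Fin m) ℝ)
    (D : Fin 2 → Matrix (Fin m) (Fin m) ℝ) (q : ℕ) : ℝ :=
  1 / (2 ^ (q + 1) * (2 ^ q - 1)) * ∑' z : chi q, kappaTerm Q D q z

def mu {m : ℕ} [NeZero m] (Q : Matrix (Fin m) (Fin m) ℝ)
    (D : Fin 2 → Matrix (Fin m) (Fin m) ℝ) (q : ℕ) : ℝ :=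
  1 / (2 ^ (q + 1) * (2 ^ q - 1)) * ∑' z : chi q, muTerm Q D z

end

/-! The idea is a renewal argument. A word containing `q` consecutive zeros is uniquely `z 0^q y`
with `z ∈ chi q`, split at the first such run. Since `D 0 ^ q` has rank one, everything before the
run decouples from everything after it: `D_0^q D_z D_0^q = D'_z(0,0) D_0^q` (`zeros_mul_mul_zeros`).
Hence, with `A w` the logarithm of the entry sum of `D_w`, the function `G y = A (0^q y)` satisfies
`G (z 0^q y) = X z + G y`, where `X z = ln |D'_z(0,0)|`.

By Fekete's lemma the exponent `L t` exists for every `t` (`exists_tendsto_log_wordMoment`). It is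
also the abscissa of convergence in `s` of the series of `2^{-|w|} exp (t A w - s |w|)` over all
words. The additivity above turns the series for `G` into a renewal equation `W = N + c W` with
`c(t,s) = ∑ p(z) exp (t X z - s τ z)`, where `p z = 2^{-(|z|+q)}` and `τ z = |z| + q`. Near the
origin `N` is finite, because words without a run of `q` zeros are exponentially rare, so `W` is
finite exactly when `c < 1`. The series for `A` obeys a delayed version of the equation and has the
same abscissa. Thus `L t` solves `c(t, L t) = 1` for small `t` (`exponent_eq_of_tiltSum_eq_one`).

The implicit function theorem (`exists_pressure`) differentiates this equation: `L'(0) = E X / E τ`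
and `L''(0) = (E X² - 2 L'(0) E (X τ) + L'(0)² E τ²) / E τ`. The moments of the waiting time `τ`
come from a recursion on blocks `0⋯01` (`moments_chi`), and the remaining expectations are `λ`, `κ`,
`μ` multiplied by `E τ`. -/

open scoped ENNReal

/-! ### Two-parameter exponential sums and the pressure equation -/

/-- The weight `a` has moments of every order in `τ` after exponential tilting by `η τ`. -/
def HasTiltedMoments {ι : Type*} (τ : ι → ℝ) (η : ℝ) (a : ι → ℝ) : Prop :=
  ∀ n : ℕ, Summable fun z => |a z| * τ z ^ n * Real.exp (η * τ z)

/-- The exponential sum `∑ a(z) exp (t X(z) - s τ(z))` as a function of `(t, s)`. -/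
noncomputable def tiltSum {ι : Type*} (X τ a : ι → ℝ) (v : ℝ × ℝ) : ℝ :=
  ∑' z, a z * Real.exp (v.1 * X z - v.2 * τ z)

/-- The linear form `(t, s) ↦ t x - s y`. -/
noncomputable def tiltForm (x y : ℝ) : ℝ × ℝ →L[ℝ] ℝ :=
  x • ContinuousLinearMap.fst ℝ ℝ ℝ - y • ContinuousLinearMap.snd ℝ ℝ ℝ

theorem tiltForm_apply (x y : ℝ) (v : ℝ × ℝ) : tiltForm x y v = v.1 * x - v.2 * y := by
  simp [tiltForm, mul_comm]

section TiltSum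

variable {ι : Type*} {X τ a b : ι → ℝ} {η K : ℝ}

/-- The factor `b` costs one power of `τ`. Asking for all orders in `HasTiltedMoments` makes the
class stable under the multiplications by `X` and `τ` that differentiation produces. -/
theorem HasTiltedMoments.mul (ha : HasTiltedMoments τ η a) (hτ : ∀ z, 1 ≤ τ z)
    (hb : ∀ z, |b z| ≤ K * τ z) : HasTiltedMoments τ η (fun z => a z * b z) := by
  intro n
  refine Summable.of_nonneg_of_le (fun z => ?_) (fun z => ?_) ((ha (n + 1)).mul_left K)
  · have := hτ z; positivity
  · have h0 : 0 ≤ τ z := zero_le_one.trans (hτ z)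
    rw [abs_mul]
    calc |a z| * |b z| * τ z ^ n * Real.exp (η * τ z)
        ≤ |a z| * (K * τ z) * τ z ^ n * Real.exp (η * τ z) := by gcongr; exact hb z
      _ = _ := by ring

/-- The norm on `ℝ × ℝ` is the maximum, so `|t| K + |s| ≤ (K + 1) ‖(t, s)‖`. This is the source of
the radius `η / (K + 1)`. -/
theorem abs_tilt_exponent_le (hτ : ∀ z, 1 ≤ τ z) (hX : ∀ z, |X z| ≤ K * τ z) (hK : 0 ≤ K)
    {v : ℝ × ℝ} (hv : (K + 1) * ‖v‖ ≤ η) (z : ι) : |v.1 * X z - v.2 * τ z| ≤ η * τ z := by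
  have h0 : 0 ≤ τ z := zero_le_one.trans (hτ z)
  have h1 : |v.1| ≤ ‖v‖ := by simpa using norm_fst_le v
  have h2 : |v.2| ≤ ‖v‖ := by simpa using norm_snd_le v
  calc |v.1 * X z - v.2 * τ z| ≤ |v.1 * X z| + |v.2 * τ z| := abs_sub _ _
    _ = |v.1| * |X z| + |v.2| * τ z := by rw [abs_mul, abs_mul, abs_of_nonneg h0]
    _ ≤ ‖v‖ * (K * τ z) + ‖v‖ * τ z := by gcongr; exact hX z
    _ = ((K + 1) * ‖v‖) * τ z := by ring
    _ ≤ η * τ z := by gcongr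

theorem HasTiltedMoments.summable (ha : HasTiltedMoments τ η a) (hτ : ∀ z, 1 ≤ τ z)
    (hX : ∀ z, |X z| ≤ K * τ z) (hK : 0 ≤ K) {v : ℝ × ℝ} (hv : (K + 1) * ‖v‖ ≤ η) :
    Summable fun z => a z * Real.exp (v.1 * X z - v.2 * τ z) := by
  refine Summable.of_norm_bounded (ha 0) fun z => ?_
  have := (abs_le.1 (abs_tilt_exponent_le hτ hX hK hv z)).2
  rw [norm_mul, Real.norm_eq_abs, Real.norm_eq_abs, Real.abs_exp, pow_zero, mul_one]
  gcongr

/-- Termwise differentiation, dominated by the first tilted moment. The partial derivatives are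
again tilted sums, with weights `a X` and `a τ`, so the lemma can be iterated. -/
theorem HasTiltedMoments.hasFDerivAt (ha : HasTiltedMoments τ η a) (hτ : ∀ z, 1 ≤ τ z)
    (hX : ∀ z, |X z| ≤ K * τ z) (hK : 0 ≤ K) {v : ℝ × ℝ} (hv : v ∈ Metric.ball 0 (η / (K + 1))) :
    HasFDerivAt (tiltSum X τ a) (tiltForm (tiltSum X τ (fun z => a z * X z) v)
      (tiltSum X τ (fun z => a z * τ z) v)) v := by
  have hK1 : 0 < K + 1 := by linarith
  have hball : ∀ w ∈ Metric.ball (0 : ℝ × ℝ) (η / (K + 1)), (K + 1) * ‖w‖ ≤ η := by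
    intro w hw
    rw [mem_ball_zero_iff, lt_div_iff₀ hK1] at hw
    linarith
  have hτ0 : ∀ z, |τ z| ≤ 1 * τ z := fun z => by
    rw [one_mul, abs_of_nonneg (zero_le_one.trans (hτ z))]
  have key := hasFDerivAt_tsum_of_isPreconnected
    (f := fun z (w : ℝ × ℝ) => a z * Real.exp (w.1 * X z - w.2 * τ z))
    (f' := fun z w => (a z * Real.exp (w.1 * X z - w.2 * τ z)) • tiltForm (X z) (τ z))
    (u := fun z => (K + 1) * (|a z| * τ z ^ 1 * Real.exp (η * τ z)))
    ((ha 1).mul_left (K + 1)) Metric.isOpen_ball (convex_ball (0 : ℝ × ℝ) _).isPreconnected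
    (fun z w _ => ?_) (fun z w hw => ?_) hv (ha.summable hτ hX hK (hball v hv)) hv
  · have h1 := (ha.mul hτ hX).summable hτ hX hK (hball v hv)
    have h2 := (ha.mul hτ hτ0).summable hτ hX hK (hball v hv)
    have h3 : (∑' z, (a z * Real.exp (v.1 * X z - v.2 * τ z)) • tiltForm (X z) (τ z)) =
        tiltForm (tiltSum X τ (fun z => a z * X z) v) (tiltSum X τ (fun z => a z * τ z) v) := by
      refine HasSum.tsum_eq ?_
      have := (h1.hasSum.smul_const (ContinuousLinearMap.fst ℝ ℝ ℝ)).sub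
        (h2.hasSum.smul_const (ContinuousLinearMap.snd ℝ ℝ ℝ))
      refine this.congr_fun fun z => ?_
      simp only [tiltForm, smul_sub, smul_smul]
      congr 2 <;> ring
    rw [← h3]
    exact key
  · have h : HasFDerivAt (fun w : ℝ × ℝ => w.1 * X z - w.2 * τ z) (tiltForm (X z) (τ z)) w := by
      have := (tiltForm (X z) (τ z)).hasFDerivAt (x := w)
      refine this.congr_of_eventuallyEq (Eventually.of_forall fun y => ?_)
      simp [tiltForm_apply]
    simpa [smul_smul] using (h.exp.const_mul (a z))
  · have h0 : 0 ≤ τ z := zero_le_one.trans (hτ z)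
    have hn : ‖tiltForm (X z) (τ z)‖ ≤ (K + 1) * τ z := by
      refine ContinuousLinearMap.opNorm_le_bound _ (by positivity) fun y => ?_
      rw [tiltForm_apply, Real.norm_eq_abs]
      have := abs_tilt_exponent_le hτ hX hK (v := y) le_rfl z
      linarith
    have := (abs_le.1 (abs_tilt_exponent_le hτ hX hK (hball w hw) z)).2
    rw [norm_smul, norm_mul, Real.norm_eq_abs, Real.norm_eq_abs, Real.abs_exp]
    calc |a z| * Real.exp (w.1 * X z - w.2 * τ z) * ‖tiltForm (X z) (τ z)‖
        ≤ |a z| * Real.exp (η * τ z) * ((K + 1) * τ z) := by gcongr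
      _ = _ := by ring

theorem HasTiltedMoments.contDiffAt (ha : HasTiltedMoments τ η a) (hτ : ∀ z, 1 ≤ τ z)
    (hX : ∀ z, |X z| ≤ K * τ z) (hK : 0 ≤ K) (hη : 0 < η) :
    ContDiffAt ℝ 1 (tiltSum X τ a) 0 := by
  have hτ0 : ∀ z, |τ z| ≤ 1 * τ z := fun z => by
    rw [one_mul, abs_of_nonneg (zero_le_one.trans (hτ z))]
  rw [contDiffAt_one_iff]
  refine ⟨_, Metric.ball 0 (η / (K + 1)), Metric.ball_mem_nhds _ (by positivity), ?_,
    fun v hv => ha.hasFDerivAt hτ hX hK hv⟩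
  intro v hv
  refine ContinuousAt.continuousWithinAt ?_
  have h1 := ((ha.mul hτ hX).hasFDerivAt hτ hX hK hv).continuousAt
  have h2 := ((ha.mul hτ hτ0).hasFDerivAt hτ hX hK hv).continuousAt
  unfold tiltForm
  exact (h1.smul continuousAt_const).sub (h2.smul continuousAt_const)

theorem tiltSum_zero (X τ a : ι → ℝ) : tiltSum X τ a 0 = ∑' z, a z := by simp [tiltSum]

/-- The solution `s = Λ(t)` of `∑ p(z) exp (t X(z) - s τ(z)) = 1` near the origin, with its first
two derivatives. -/
theorem exists_pressure {p : ι → ℝ} (hp : ∀ z, 0 ≤ p z) (hp1 : ∑' z, p z = 1)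
    (hpm : HasTiltedMoments τ η p) (hτ : ∀ z, 1 ≤ τ z) (hX : ∀ z, |X z| ≤ K * τ z) (hK : 0 ≤ K)
    (hη : 0 < η) :
    ∃ Λ : ℝ → ℝ, Λ 0 = 0 ∧ ContinuousAt Λ 0 ∧ (∀ᶠ t in 𝓝 0, tiltSum X τ p (t, Λ t) = 1) ∧
      (∀ᶠ t in 𝓝 0, DifferentiableAt ℝ Λ t) ∧
      HasDerivAt Λ ((∑' z, p z * X z) / ∑' z, p z * τ z) 0 ∧
      HasDerivAt (deriv Λ) (((∑' z, p z * X z * X z)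
        - 2 * ((∑' z, p z * X z) / ∑' z, p z * τ z) * (∑' z, p z * X z * τ z)
        + ((∑' z, p z * X z) / ∑' z, p z * τ z) ^ 2 * ∑' z, p z * τ z * τ z) /
          ∑' z, p z * τ z) 0 := by
  have hτ0 : ∀ z, |τ z| ≤ 1 * τ z := fun z => by
    rw [one_mul, abs_of_nonneg (zero_le_one.trans (hτ z))]
  have hr : 0 < η / (K + 1) := by positivity
  have h0 : (0 : ℝ × ℝ) ∈ Metric.ball (0 : ℝ × ℝ) (η / (K + 1)) := Metric.mem_ball_self hr
  have hmτ : 0 < ∑' z, p z * τ z := by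
    -- A divergent sum would have the default value 0, not 1.
    have hs1 : Summable p := by
      by_contra h
      rw [tsum_eq_zero_of_not_summable h] at hp1
      norm_num at hp1
    have hs2 : Summable fun z => p z * τ z := by
      simpa using (hpm.mul hτ hτ0).summable (v := 0) hτ hX hK (by simpa using hη.le)
    have := hs1.tsum_le_tsum (fun z => le_mul_of_one_le_right (hp z) (hτ z)) hs2
    linarith
  have hf0 := hpm.hasFDerivAt hτ hX hK h0
  have cdf := hpm.contDiffAt hτ hX hK hη
  -- The partial derivative in `s` at the origin is `-E τ`, which is nonzero because `τ ≥ 1`.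
  have hinv : (fderiv ℝ (tiltSum X τ p) 0 ∘L .inr ℝ ℝ ℝ).IsInvertible := by
    rw [hf0.fderiv]
    refine ⟨ContinuousLinearEquiv.unitsEquivAut ℝ (Units.mk0 (-∑' z, p z * τ z) (by linarith)), ?_⟩
    ext
    simp [tiltForm_apply, tiltSum_zero]
  set Λ := cdf.implicitFunction one_ne_zero hinv with hΛ
  have hΛ0 : Λ 0 = 0 := cdf.implicitFunction_apply_self one_ne_zero hinv
  have hΛc : ContDiffAt ℝ 1 Λ 0 := cdf.contDiffAt_implicitFunction one_ne_zero hinv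
  have heq : ∀ᶠ t in 𝓝 (0 : ℝ), tiltSum X τ p (t, Λ t) = 1 := by
    have := cdf.eventually_apply_implicitFunction one_ne_zero hinv
    rw [tiltSum_zero, hp1] at this
    exact this
  have hdiff : ∀ᶠ t in 𝓝 (0 : ℝ), DifferentiableAt ℝ Λ t := by
    filter_upwards [hΛc.eventually (by simp)] with t ht
    exact ht.differentiableAt one_ne_zero
  have hγc : ContinuousAt (fun t => (t, Λ t)) 0 := continuousAt_id.prodMk hΛc.continuousAt
  have hγ0 : ((0 : ℝ), Λ 0) = (0 : ℝ × ℝ) := by simp [hΛ0]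
  have hball : ∀ᶠ t in 𝓝 (0 : ℝ), (t, Λ t) ∈ Metric.ball (0 : ℝ × ℝ) (η / (K + 1)) := by
    refine hγc.eventually_mem ?_
    rw [hγ0]
    exact Metric.ball_mem_nhds _ hr
  have hchain : ∀ {a : ι → ℝ} {t l : ℝ}, HasTiltedMoments τ η a →
      (t, Λ t) ∈ Metric.ball (0 : ℝ × ℝ) (η / (K + 1)) → HasDerivAt Λ l t →
      HasDerivAt (fun t => tiltSum X τ a (t, Λ t)) (tiltSum X τ (fun z => a z * X z) (t, Λ t)
        - l * tiltSum X τ (fun z => a z * τ z) (t, Λ t)) t := by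
    intro a t l ha ht hl
    have := (ha.hasFDerivAt hτ hX hK ht).comp_hasDerivAt t ((hasDerivAt_id t).prodMk hl)
    simpa [tiltForm_apply, Function.comp_def] using this
  have hden : ∀ᶠ t in 𝓝 (0 : ℝ), tiltSum X τ (fun z => p z * τ z) (t, Λ t) ≠ 0 := by
    have hc : ContinuousAt (fun t => tiltSum X τ (fun z => p z * τ z) (t, Λ t)) 0 := by
      refine ContinuousAt.comp (g := tiltSum X τ (fun z => p z * τ z)) ?_ hγc
      rw [hγ0]
      exact ((hpm.mul hτ hτ0).hasFDerivAt hτ hX hK h0).continuousAt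
    refine hc.eventually_ne ?_
    rw [hΛ0]
    change tiltSum X τ _ 0 ≠ 0
    rw [tiltSum_zero]
    exact hmτ.ne'
  -- Differentiating the constant `tiltSum X τ p (t, Λ t) = 1` gives `Λ'` near 0 as a quotient of
  -- tilted sums; these are differentiable along the curve, so `C¹` regularity of `Λ` suffices to
  -- reach the second derivative.
  have hderiv : ∀ᶠ t in 𝓝 (0 : ℝ), deriv Λ t = tiltSum X τ (fun z => p z * X z) (t, Λ t) /
      tiltSum X τ (fun z => p z * τ z) (t, Λ t) := by
    filter_upwards [heq.eventually_nhds, hdiff, hball, hden] with t ht hd hb hne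
    have h1 := hchain hpm hb hd.hasDerivAt
    have h2 : HasDerivAt (fun t => tiltSum X τ p (t, Λ t)) 0 t :=
      (hasDerivAt_const t (1 : ℝ)).congr_of_eventuallyEq ht
    have := h1.unique h2
    rw [eq_div_iff hne]
    linarith
  have hd0 : HasDerivAt Λ ((∑' z, p z * X z) / ∑' z, p z * τ z) 0 := by
    have := hdiff.self_of_nhds.hasDerivAt
    rw [hderiv.self_of_nhds, hΛ0] at this
    simpa only [tiltSum_zero, ← Prod.zero_eq_mk] using this
  refine ⟨Λ, hΛ0, hΛc.continuousAt, heq, hdiff, hd0, ?_⟩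
  have hb0 : ((0 : ℝ), Λ 0) ∈ Metric.ball (0 : ℝ × ℝ) (η / (K + 1)) := hball.self_of_nhds
  have hq := (hchain (hpm.mul hτ hX) hb0 hd0).div (hchain (hpm.mul hτ hτ0) hb0 hd0)
    hden.self_of_nhds
  simp only [hΛ0, ← Prod.zero_eq_mk, tiltSum_zero] at hq
  refine (hq.congr_of_eventuallyEq hderiv).congr_deriv ?_
  have hcomm : ∑' z, p z * τ z * X z = ∑' z, p z * X z * τ z :=
    tsum_congr fun z => by ring
  rw [hcomm]
  field_simp
  ring

end TiltSum

/-! ### Combinatorics of words and runs of zeros -/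

/-- The binary words that contain no `q` consecutive zeros. -/
def noZeroRun (q : ℕ) : Set (List (Fin 2)) := {w | ¬ List.replicate q 0 <:+: w}

theorem chi_subset_noZeroRun (q : ℕ) : chi q ⊆ noZeroRun q := fun _ hz => hz.1

theorem not_replicate_prefix {q j : ℕ} (h : j < q) (w : List (Fin 2)) :
    ¬ List.replicate q (0 : Fin 2) <+: List.replicate j 0 ++ 1 :: w := by
  induction j generalizing q with
  | zero =>
    obtain ⟨q, rfl⟩ := Nat.exists_eq_succ_of_ne_zero h.ne'
    simp [List.replicate_succ, List.cons_prefix_cons]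
  | succ j ih =>
    obtain ⟨q, rfl⟩ := Nat.exists_eq_succ_of_ne_zero (Nat.ne_zero_of_lt h)
    simp only [List.replicate_succ, List.cons_append, List.cons_prefix_cons, true_and]
    exact ih (by omega)

/-- A run of `q` zeros cannot contain the digit 1, and the zeros before it are fewer than `q`, so
any such run lies inside `w`. -/
theorem replicate_append_one_cons_mem_noZeroRun {q j : ℕ} (h : j < q) (w : List (Fin 2)) :
    List.replicate j 0 ++ 1 :: w ∈ noZeroRun q ↔ w ∈ noZeroRun q := by
  refine not_congr ?_
  induction j with
  | zero =>
    have := not_replicate_prefix h w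
    simp only [List.replicate_zero, List.nil_append] at this ⊢
    rw [List.infix_cons_iff]
    tauto
  | succ j ih =>
    have := not_replicate_prefix h w
    rw [List.replicate_succ, List.cons_append] at this ⊢
    rw [List.infix_cons_iff, ih (by omega)]
    tauto

theorem replicate_mem_noZeroRun {q i : ℕ} : List.replicate i 0 ∈ noZeroRun q ↔ i < q := by
  rw [← not_le]
  refine not_congr ⟨fun h => by simpa using h.length_le, fun h => ?_⟩
  obtain ⟨k, rfl⟩ := Nat.exists_eq_add_of_le h
  rw [List.replicate_add]
  exact (List.prefix_append _ _).isInfix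

theorem word_eq_replicate_or (w : List (Fin 2)) : (∃ i, w = List.replicate i 0) ∨
    ∃ j w', w = List.replicate j 0 ++ 1 :: w' := by
  induction w with
  | nil => exact .inl ⟨0, rfl⟩
  | cons a w ih =>
    fin_cases a
    · rcases ih with ⟨i, rfl⟩ | ⟨j, w', rfl⟩
      · exact .inl ⟨i + 1, rfl⟩
      · exact .inr ⟨j + 1, w', rfl⟩
    · exact .inr ⟨0, w, rfl⟩

theorem replicate_append_one_cons_inj {j j' : ℕ} {w w' : List (Fin 2)}
    (h : List.replicate j 0 ++ 1 :: w = List.replicate j' 0 ++ 1 :: w') : j = j' ∧ w = w' := by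
  induction j generalizing j' with
  | zero => cases j' <;> simp_all [List.replicate_succ]
  | succ j ih =>
    cases j' with
    | zero => simp [List.replicate_succ] at h
    | succ j' =>
      simp only [List.replicate_succ, List.cons_append, List.cons.injEq, true_and] at h
      simpa using ih h

theorem exists_block_of_mem_noZeroRun {q : ℕ} {w : List (Fin 2)} (hw : w ∈ noZeroRun q) :
    (∃ i < q, w = List.replicate i 0) ∨
      ∃ j < q, ∃ w' ∈ noZeroRun q, w = List.replicate j 0 ++ 1 :: w' := by
  rcases word_eq_replicate_or w with ⟨i, rfl⟩ | ⟨j, w', rfl⟩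
  · exact .inl ⟨i, replicate_mem_noZeroRun.1 hw, rfl⟩
  · have hj : j < q := by
      by_contra h
      refine hw ?_
      obtain ⟨k, rfl⟩ := Nat.exists_eq_add_of_le (not_lt.1 h)
      rw [List.replicate_add, List.append_assoc]
      exact (List.prefix_append _ _).isInfix
    exact .inr ⟨j, hj, w', (replicate_append_one_cons_mem_noZeroRun hj w').1 hw, rfl⟩

theorem nil_mem_chi {q : ℕ} (hq : 1 ≤ q) : [] ∈ chi q := by
  refine ⟨?_, by simp⟩
  simp only [List.infix_nil, List.replicate_eq_nil_iff]
  omega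

theorem replicate_append_one_cons_mem_chi {q j : ℕ} (h : j < q) (w : List (Fin 2)) :
    List.replicate j 0 ++ 1 :: w ∈ chi q ↔ w ∈ chi q := by
  refine and_congr (replicate_append_one_cons_mem_noZeroRun h w) ?_
  cases hw : w.getLast? <;> simp [List.getLast?_cons, hw]

/-- Prepending a block `0 ⋯ 0 1` of length at most `q`, or the empty word. -/
def chiBlock (q : ℕ) (hq : 1 ≤ q) : Option (Fin q × chi q) → chi q
  | none => ⟨[], nil_mem_chi hq⟩
  | some (j, z) => ⟨List.replicate j 0 ++ 1 :: z,
      (replicate_append_one_cons_mem_chi j.2 z).2 z.2⟩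

/-- The position of the first 1 determines the block. A word of zeros only is in `chi q` only if it
is empty, because of the condition on the last digit. -/
theorem chiBlock_bijective (q : ℕ) (hq : 1 ≤ q) : Function.Bijective (chiBlock q hq) := by
  constructor
  · rintro (_ | ⟨j, z⟩) (_ | ⟨j', z'⟩) h
    · rfl
    · simp [chiBlock] at h
    · simp [chiBlock] at h
    · simp only [chiBlock, Subtype.mk.injEq] at h
      obtain ⟨h1, h2⟩ := replicate_append_one_cons_inj h
      rw [Fin.ext h1, Subtype.ext h2]
  · rintro ⟨z, hz⟩
    rcases exists_block_of_mem_noZeroRun hz.1 with ⟨i, _, rfl⟩ | ⟨j, hj, w, _, rfl⟩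
    · refine ⟨none, ?_⟩
      cases i with
      | zero => rfl
      | succ i => simpa [List.getLast?_replicate] using hz.2
    · exact ⟨some (⟨j, hj⟩, ⟨w, (replicate_append_one_cons_mem_chi hj w).1 hz⟩), rfl⟩

/-- The word `z 0^q y`. -/
def insertZeros (q : ℕ) (p : chi q × List (Fin 2)) : List (Fin 2) :=
  (p.1 : List (Fin 2)) ++ (List.replicate q 0 ++ p.2)

/-- Two splittings differ by a segment `s`. If `s` is at least as long as the run, it contains it,
against `z ++ s ∈ chi q`; otherwise a nonempty `s` is a piece of the run and ends in 0, again a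
contradiction. -/
theorem insertZeros_inj_aux {q : ℕ} {z s y y' : List (Fin 2)} (hz : z ++ s ∈ chi q)
    (h : List.replicate q 0 ++ y = s ++ (List.replicate q 0 ++ y')) : s = [] := by
  by_contra hs
  rcases List.append_eq_append_iff.1 h with ⟨r, hr, -⟩ | ⟨r, hr, -⟩
  · refine hz.1 ?_
    rw [hr]
    exact List.infix_append' _ _ _
  · have hlast := hz.2 (s.getLast hs) (by
      rw [List.getLast?_append_of_ne_nil _ hs, List.getLast?_eq_some_getLast hs]; rfl)
    have : s.getLast hs ∈ List.replicate q (0 : Fin 2) := by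
      rw [hr]; exact List.mem_append_left _ (List.getLast_mem hs)
    rw [List.eq_of_mem_replicate this] at hlast
    simp at hlast

theorem insertZeros_injective (q : ℕ) : Function.Injective (insertZeros q) := by
  rintro ⟨⟨z, hz⟩, y⟩ ⟨⟨z', hz'⟩, y'⟩ h
  simp only [insertZeros] at h
  have key : z = z' := by
    rcases List.append_eq_append_iff.1 h with ⟨s, rfl, h2⟩ | ⟨s, rfl, h2⟩
    · rw [insertZeros_inj_aux hz' h2, List.append_nil]
    · rw [insertZeros_inj_aux hz h2, List.append_nil]
  subst key
  simpa using h

/-- Descent on the part before a run: if it is not in `chi q`, it either contains an earlier run or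
ends in 0, and in the second case the run can be moved one place to the left. -/
theorem range_insertZeros {q : ℕ} (hq : 1 ≤ q) : Set.range (insertZeros q) = (noZeroRun q)ᶜ := by
  ext w
  simp only [noZeroRun, Set.mem_range, Set.mem_compl_iff, Set.mem_ofPred_eq, not_not]
  constructor
  · rintro ⟨⟨z, y⟩, rfl⟩
    exact ⟨z, y, by simp [insertZeros]⟩
  · rintro ⟨s, y, h⟩
    induction hn : s.length using Nat.strong_induction_on generalizing s y with
    | _ n ih =>
    by_cases hs : s ∈ chi q
    · exact ⟨(⟨s, hs⟩, y), by simpa [insertZeros] using h⟩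
    · rw [chi, Set.mem_ofPred_eq, not_and_or, not_not] at hs
      rcases hs with ⟨a, b, hab⟩ | hs
      · refine ih a.length ?_ a (b ++ List.replicate q 0 ++ y) ?_ rfl
        · have := congrArg List.length hab
          simp at this
          omega
        · rw [← h, ← hab]; simp
      · push Not at hs
        obtain ⟨a, ha, ha1⟩ := hs
        have ha0 : a = 0 := by omega
        subst ha0
        obtain ⟨s', rfl⟩ := List.getLast?_eq_some_iff.1 ha
        refine ih s'.length (by simp at hn; omega) s' (0 :: y) ?_ rfl
        rw [← h]
        have : List.replicate q (0 : Fin 2) ++ [0] = 0 :: List.replicate q 0 := by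
          rw [← List.replicate_succ, ← List.replicate_succ']
        simp only [List.append_assoc]
        rw [← List.singleton_append (l := y), ← List.append_assoc (List.replicate q 0), this]
        simp

/-- Splitting a sum over all words at the first block of `q` zeros. -/
theorem tsum_words_eq {q : ℕ} (hq : 1 ≤ q) (f : List (Fin 2) → ℝ≥0∞) :
    ∑' w, f w = (∑' w : noZeroRun q, f w) +
      ∑' (z : chi q) (y : List (Fin 2)), f ((z : List (Fin 2)) ++ (List.replicate q 0 ++ y)) := by
  rw [← ENNReal.summable.tsum_add_tsum_compl (s := noZeroRun q) ENNReal.summable]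
  congr 1
  rw [← range_insertZeros hq, tsum_range f (insertZeros_injective q), ENNReal.tsum_prod']
  rfl

/-! ### Finiteness of sums over words -/

/-- A self-bounding inequality for truncated sums gives a finite sum. -/
theorem tsum_ne_top_of_truncation {α : Type*} (len : α → ℕ) {f : α → ℝ≥0∞} {C r : ℝ≥0∞}
    (hC : C ≠ ⊤) (hr : r < 1) (hlen : ∀ n, {a | len a ≤ n}.Finite) (hf : ∀ a, f a ≠ ⊤)
    (h : ∀ n, ∑' a, {a | len a ≤ n}.indicator f a ≤ C + r * ∑' a, {a | len a ≤ n}.indicator f a) :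
    ∑' a, f a ≠ ⊤ := by
  have hr0 : 1 - r ≠ 0 := (tsub_pos_of_lt hr).ne'
  refine ne_top_of_le_ne_top (b := C / (1 - r)) (ENNReal.div_ne_top hC hr0) ?_
  have hn : ∀ n, ∑' a, {a | len a ≤ n}.indicator f a ≤ C / (1 - r) := by
    intro n
    -- Only finitely many terms survive the truncation; finiteness is what allows `r * T` to be
    -- subtracted in `ℝ≥0∞`.
    have hfin : ∑' a, {a | len a ≤ n}.indicator f a ≠ ⊤ := by
      rw [tsum_eq_sum (s := (hlen n).toFinset)]
      · refine ENNReal.sum_ne_top.2 fun a _ => ?_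
        by_cases ha : len a ≤ n <;> simp [Set.indicator, ha, hf]
      · intro a ha
        exact Set.indicator_of_notMem (by simpa using ha) _
    rw [ENNReal.le_div_iff_mul_le (.inl hr0) (.inl (ne_top_of_le_ne_top ENNReal.one_ne_top
      tsub_le_self)), mul_comm, ENNReal.sub_mul (fun _ _ => hfin), one_mul]
    exact tsub_le_iff_right.2 (h n)
  rw [ENNReal.tsum_eq_iSup_sum]
  refine iSup_le fun s => le_trans ?_ (hn (s.sup len))
  refine le_trans (Finset.sum_le_sum fun a ha => ?_) (ENNReal.sum_le_tsum s)
  rw [Set.indicator_of_mem]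
  exact Finset.le_sup (f := len) ha

/-- Such a word is `0^i` or `0^j 1 w'` with `i, j < q` and `w'` of the same kind, so the sum bounds
itself with ratio `r = ∑ s^(j+1)`. -/
theorem tsum_noZeroRun_ne_top {q : ℕ} {s : ℝ≥0∞} (hs : s ≠ ⊤)
    (hr : ∑ j : Fin q, s ^ (j + 1 : ℕ) < 1) :
    ∑' w : noZeroRun q, s ^ (w : List (Fin 2)).length ≠ ⊤ := by
  refine tsum_ne_top_of_truncation (fun w : noZeroRun q => (w : List (Fin 2)).length)
    (C := ∑ i : Fin q, s ^ (i : ℕ)) ?_ hr (fun n => ?_) (fun a => ENNReal.pow_ne_top hs)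
    (fun n => ?_)
  · exact ENNReal.sum_ne_top.2 fun a _ => ENNReal.pow_ne_top hs
  · exact (List.finite_length_le (Fin 2) n).preimage Subtype.val_injective.injOn
  set F := {w : noZeroRun q | (w : List (Fin 2)).length ≤ n}.indicator
    (fun w : noZeroRun q => s ^ (w : List (Fin 2)).length) with hF
  let e : Fin q ⊕ Fin q × noZeroRun q → noZeroRun q :=
    Sum.elim (fun i => ⟨List.replicate i 0, replicate_mem_noZeroRun.2 i.2⟩)
      (fun x => ⟨List.replicate x.1 0 ++ 1 :: x.2,
        (replicate_append_one_cons_mem_noZeroRun x.1.2 _).2 x.2.2⟩)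
  have he : Function.Surjective e := by
    rintro ⟨w, hw⟩
    rcases exists_block_of_mem_noZeroRun hw with ⟨i, hi, rfl⟩ | ⟨j, hj, w', hw', rfl⟩
    · exact ⟨.inl ⟨i, hi⟩, rfl⟩
    · exact ⟨.inr (⟨j, hj⟩, ⟨w', hw'⟩), rfl⟩
  refine (ENNReal.tsum_le_tsum_comp_of_surjective he F).trans ?_
  rw [ENNReal.summable.tsum_sum ENNReal.summable, tsum_fintype, ENNReal.tsum_prod', tsum_fintype,
    Finset.sum_mul]
  refine add_le_add (Finset.sum_le_sum fun i _ => ?_) (Finset.sum_le_sum fun j _ => ?_)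
  · refine (Set.indicator_le_self _ _ _).trans ?_
    simp [e]
  · rw [← ENNReal.tsum_mul_left]
    refine ENNReal.tsum_le_tsum fun w => ?_
    have hl : ((e (.inr (j, w)) : noZeroRun q) : List (Fin 2)).length =
      j + 1 + (w : List (Fin 2)).length := by simp [e]; ring
    by_cases h : ((e (.inr (j, w)) : noZeroRun q) : List (Fin 2)).length ≤ n
    · rw [hF, Set.indicator_of_mem (by exact h), Set.indicator_of_mem (by
        rw [Set.mem_ofPred_eq]; omega), hl, pow_add]
    · rw [hF, Set.indicator_of_notMem (by exact h)]
      exact zero_le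

/-! ### Exponential tails and moments of the waiting time for `0^q` -/

theorem sum_half_pow (q : ℕ) : ∑ j : Fin q, (1 / 2 : ℝ) ^ (j + 1 : ℕ) = 1 - (1 / 2) ^ q := by
  induction q with
  | zero => simp
  | succ q ih =>
    rw [Fin.sum_univ_castSucc]
    simp only [Fin.val_castSucc, Fin.val_last, ih]
    ring

theorem sum_mul_half_pow (q : ℕ) : ∑ j : Fin q, ((j : ℝ) + 1) * (1 / 2) ^ (j + 1 : ℕ) =
    2 - (q + 2) * (1 / 2) ^ q := by
  induction q with
  | zero => simp
  | succ q ih =>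
    rw [Fin.sum_univ_castSucc]
    simp only [Fin.val_castSucc, Fin.val_last, ih]
    push_cast
    ring

theorem sum_sq_mul_half_pow (q : ℕ) : ∑ j : Fin q, ((j : ℝ) + 1) ^ 2 * (1 / 2) ^ (j + 1 : ℕ) =
    6 - ((q : ℝ) ^ 2 + 4 * q + 6) * (1 / 2) ^ q := by
  induction q with
  | zero => norm_num
  | succ q ih =>
    rw [Fin.sum_univ_castSucc]
    simp only [Fin.val_castSucc, Fin.val_last, ih]
    push_cast
    ring

/-- At `s = 1/2` the ratio is `1 - 2^{-q} < 1`, and by continuity it stays below 1 for `s = e^η / 2`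
with small `η > 0`. -/
theorem exists_summable_noZeroRun (q : ℕ) : ∃ η : ℝ, 0 < η ∧
    Summable fun w : noZeroRun q =>
      (1 / 2 : ℝ) ^ (w : List (Fin 2)).length * Real.exp (η * (w : List (Fin 2)).length) := by
  have hc : Tendsto (fun η : ℝ => ∑ j : Fin q, (1 / 2 * Real.exp η) ^ (j + 1 : ℕ)) (𝓝[>] 0)
      (𝓝 (∑ j : Fin q, (1 / 2 * Real.exp 0) ^ (j + 1 : ℕ))) := by
    refine ((Continuous.tendsto ?_ 0).mono_left nhdsWithin_le_nhds)
    fun_prop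
  rw [Real.exp_zero, mul_one, sum_half_pow] at hc
  have hlt : (1 : ℝ) - (1 / 2) ^ q < 1 := by simp
  obtain ⟨η, h1, h2⟩ := ((hc.eventually_lt_const hlt).and self_mem_nhdsWithin).exists
  refine ⟨η, h2, ?_⟩
  have hs0 : (0 : ℝ) ≤ 1 / 2 * Real.exp η := by positivity
  have := tsum_noZeroRun_ne_top (q := q) (s := ENNReal.ofReal (1 / 2 * Real.exp η))
    ENNReal.ofReal_ne_top (by
      simp_rw [← ENNReal.ofReal_pow hs0]
      rw [← ENNReal.ofReal_sum_of_nonneg fun i _ => by positivity, ← ENNReal.ofReal_one]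
      exact (ENNReal.ofReal_lt_ofReal_iff one_pos).2 h1)
  have h3 := ENNReal.summable_toReal this
  refine h3.congr fun w => ?_
  rw [ENNReal.toReal_pow, ENNReal.toReal_ofReal hs0, mul_pow, ← Real.exp_nat_mul, mul_comm η]

/-- Half of the exponential rate is spent on absorbing the power. -/
theorem pow_mul_exp_le {η x : ℝ} (hη : 0 < η) (hx : 0 ≤ x) (n : ℕ) :
    x ^ n * Real.exp (η / 2 * x) ≤ n.factorial * (2 / η) ^ n * Real.exp (η * x) := by
  have h := Real.pow_div_factorial_le_exp (η / 2 * x) (by positivity) n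
  rw [div_le_iff₀ (by positivity)] at h
  have h2 : x ^ n = (2 / η) ^ n * (η / 2 * x) ^ n := by rw [← mul_pow]; congr 1; field_simp
  calc x ^ n * Real.exp (η / 2 * x)
      ≤ (2 / η) ^ n * (Real.exp (η / 2 * x) * n.factorial) * Real.exp (η / 2 * x) := by
        rw [h2]; gcongr
    _ = n.factorial * (2 / η) ^ n * (Real.exp (η / 2 * x) * Real.exp (η / 2 * x)) := by ring
    _ = _ := by rw [← Real.exp_add]; congr 2; ring

/-- The first time at which a word starting with `z 0^q` has shown `q` consecutive zeros. -/
def chiTime (q : ℕ) (z : chi q) : ℝ := (z : List (Fin 2)).length + q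

/-- The probability that fair coin tosses begin with `z 0^q`. -/
noncomputable def chiProb (q : ℕ) (z : chi q) : ℝ := (1 / 2) ^ ((z : List (Fin 2)).length + q)

theorem one_le_chiTime {q : ℕ} (hq : 1 ≤ q) (z : chi q) : 1 ≤ chiTime q z := by
  have : (1 : ℝ) ≤ q := by exact_mod_cast hq
  unfold chiTime
  have h0 : (0 : ℝ) ≤ (z : List (Fin 2)).length := Nat.cast_nonneg _
  linarith

theorem exists_hasTiltedMoments_chi (q : ℕ) : ∃ η : ℝ, 0 < η ∧
    (Summable fun w : noZeroRun q =>
      (1 / 2 : ℝ) ^ (w : List (Fin 2)).length * Real.exp (η * (w : List (Fin 2)).length)) ∧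
    HasTiltedMoments (chiTime q) η (chiProb q) := by
  obtain ⟨η, hη, hs⟩ := exists_summable_noZeroRun q
  refine ⟨η / 2, by positivity, ?_, fun n => ?_⟩
  · refine Summable.of_nonneg_of_le (fun w => by positivity) (fun w => ?_) hs
    gcongr
    linarith
  · have hs' : Summable fun z : chi q =>
        (1 / 2 : ℝ) ^ (z : List (Fin 2)).length * Real.exp (η * (z : List (Fin 2)).length) := by
      have h := hs.comp_injective (Set.inclusion_injective (chi_subset_noZeroRun q))
      exact h.congr fun z => rfl
    refine Summable.of_nonneg_of_le (fun z => ?_) (fun z => ?_)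
      (hs'.mul_left ((1 / 2) ^ q * Real.exp (η * q) * (n.factorial * (2 / η) ^ n)))
    · unfold chiTime; positivity
    · have h := pow_mul_exp_le hη (x := chiTime q z) (by unfold chiTime; positivity) n
      have hp : 0 ≤ chiProb q z := by unfold chiProb; positivity
      rw [abs_of_nonneg hp, mul_assoc]
      refine (mul_le_mul_of_nonneg_left h hp).trans_eq ?_
      rw [chiTime, chiProb, mul_add, Real.exp_add, pow_add]
      ring

/-- Removing the first block `0^j 1`, of length `j + 1`, is a bijection away from the empty word.
For `f n = n^k 2^{-n}` this yields linear equations for the moments. -/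
theorem tsum_chi_length {q : ℕ} (hq : 1 ≤ q) {f : ℕ → ℝ}
    (hf : Summable fun z : chi q => f (z : List (Fin 2)).length) :
    ∑' z : chi q, f (z : List (Fin 2)).length =
      f 0 + ∑ j : Fin q, ∑' z : chi q, f (j + 1 + (z : List (Fin 2)).length) := by
  let e := Equiv.ofBijective _ (chiBlock_bijective q hq)
  have hs : Summable fun x => f (e x : List (Fin 2)).length :=
    (e.summable_iff (f := fun z : chi q => f (z : List (Fin 2)).length)).2 hf
  have hs' : Summable fun x : Fin q × chi q => f (e (some x) : List (Fin 2)).length := by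
    have h := hs.comp_injective (Option.some_injective _)
    exact h.congr fun z => rfl
  have hlen : ∀ x : Fin q × chi q, (e (some x) : List (Fin 2)).length =
      x.1 + 1 + (x.2 : List (Fin 2)).length := by
    rintro ⟨j, z⟩
    simp only [e, Equiv.ofBijective_apply, chiBlock, List.length_append, List.length_replicate,
      List.length_cons]
    ring
  rw [← e.tsum_eq, ← (Equiv.optionEquivSumPUnit.{0} _).symm.tsum_eq, Summable.tsum_sum]
  · simp only [Equiv.optionEquivSumPUnit_symm_inl, Equiv.optionEquivSumPUnit_symm_inr]
    rw [hs'.tsum_prod, tsum_fintype, add_comm]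
    simp only [hlen]
    simp [e, chiBlock]
  · exact hs'.congr fun x => by simp
  · exact (hasSum_fintype _).summable

theorem moments_chi {q : ℕ} (hq : 1 ≤ q) :
    (∑' z, chiProb q z = 1) ∧ (∑' z, chiProb q z * chiTime q z = 2 * (2 ^ q - 1)) ∧
      ∑' z, chiProb q z * chiTime q z * chiTime q z =
        2 * (2 ^ q - 1) + 4 * (2 ^ (2 * q + 1) - (3 + (q : ℝ)) * 2 ^ q + 1) := by
  obtain ⟨η, hη, -, hm⟩ := exists_hasTiltedMoments_chi q
  have hsum : ∀ n : ℕ, Summable fun z : chi q =>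
      ((z : List (Fin 2)).length : ℝ) ^ n * (1 / 2) ^ (z : List (Fin 2)).length := by
    intro n
    refine Summable.of_nonneg_of_le (fun z => by positivity) (fun z => ?_)
      ((hm n).mul_left (2 ^ q))
    have hτ : 0 ≤ chiTime q z := by unfold chiTime; positivity
    have h1 : ((z : List (Fin 2)).length : ℝ) ^ n ≤ chiTime q z ^ n := by
      gcongr; simp [chiTime]
    have h2 : 1 ≤ Real.exp (η * chiTime q z) := Real.one_le_exp (by positivity)
    rw [abs_of_nonneg (by unfold chiProb; positivity), chiProb, pow_add]
    calc ((z : List (Fin 2)).length : ℝ) ^ n * (1 / 2) ^ (z : List (Fin 2)).length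
        ≤ chiTime q z ^ n * (1 / 2) ^ (z : List (Fin 2)).length * 1 := by
          rw [mul_one]; gcongr
      _ ≤ chiTime q z ^ n * (1 / 2) ^ (z : List (Fin 2)).length * Real.exp (η * chiTime q z) := by
          gcongr
      _ = 2 ^ q * (1 / 2) ^ q * (chiTime q z ^ n * (1 / 2) ^ (z : List (Fin 2)).length *
          Real.exp (η * chiTime q z)) := by rw [← mul_pow]; norm_num
      _ = _ := by ring
  have hs0 : Summable fun z : chi q => (1 / 2 : ℝ) ^ (z : List (Fin 2)).length := by
    simpa using hsum 0
  have hs1 : Summable fun z : chi q =>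
      ((z : List (Fin 2)).length : ℝ) * (1 / 2) ^ (z : List (Fin 2)).length := by
    simpa using hsum 1
  have hs2 := hsum 2
  have e0 := tsum_chi_length hq (f := fun n => (1 / 2 : ℝ) ^ n) hs0
  have e1 := tsum_chi_length hq (f := fun n => (n : ℝ) * (1 / 2 : ℝ) ^ n) hs1
  have e2 := tsum_chi_length hq (f := fun n => (n : ℝ) ^ 2 * (1 / 2 : ℝ) ^ n) hs2
  set S0 := ∑' z : chi q, (1 / 2 : ℝ) ^ (z : List (Fin 2)).length with hS0
  set S1 := ∑' z : chi q,
    ((z : List (Fin 2)).length : ℝ) * (1 / 2) ^ (z : List (Fin 2)).length with hS1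
  set S2 := ∑' z : chi q,
    ((z : List (Fin 2)).length : ℝ) ^ 2 * (1 / 2) ^ (z : List (Fin 2)).length with hS2
  -- The recursions `r0`, `r1`, `r2` form a triangular system: each has coefficient `2^{-q}` on its
  -- unknown after rearrangement.
  have r0 : S0 = 1 + (1 - (1 / 2) ^ q) * S0 := by
    refine e0.trans ?_
    rw [← sum_half_pow, Finset.sum_mul, pow_zero]
    congr 1
    refine Finset.sum_congr rfl fun j _ => ?_
    simp_rw [pow_add _ (j + 1 : ℕ)]
    exact tsum_mul_left
  have r1 : S1 = (1 - (1 / 2) ^ q) * S1 + (2 - (q + 2) * (1 / 2) ^ q) * S0 := by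
    refine e1.trans ?_
    rw [← sum_half_pow, ← sum_mul_half_pow, Finset.sum_mul, Finset.sum_mul,
      ← Finset.sum_add_distrib]
    simp only [Nat.cast_zero, zero_mul, zero_add]
    refine Finset.sum_congr rfl fun j _ => HasSum.tsum_eq ?_
    refine ((hs1.hasSum.mul_left _).add (hs0.hasSum.mul_left _)).congr_fun fun z => ?_
    push_cast
    ring
  have r2 : S2 = (1 - (1 / 2) ^ q) * S2 + 2 * (2 - (q + 2) * (1 / 2) ^ q) * S1 +
      (6 - (q ^ 2 + 4 * q + 6) * (1 / 2) ^ q) * S0 := by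
    refine e2.trans ?_
    rw [← sum_half_pow, ← sum_mul_half_pow, ← sum_sq_mul_half_pow, Finset.mul_sum,
      Finset.sum_mul, Finset.sum_mul, Finset.sum_mul, ← Finset.sum_add_distrib,
      ← Finset.sum_add_distrib]
    simp only [Nat.cast_zero, ne_eq, OfNat.ofNat_ne_zero, not_false_eq_true, zero_pow, zero_mul,
      zero_add]
    refine Finset.sum_congr rfl fun j _ => HasSum.tsum_eq ?_
    refine (((hs2.hasSum.mul_left _).add (hs1.hasSum.mul_left _)).add
      (hs0.hasSum.mul_left _)).congr_fun fun z => ?_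
    push_cast
    ring
  have m0 : ∑' z, chiProb q z = (1 / 2) ^ q * S0 := by
    refine HasSum.tsum_eq ((hs0.hasSum.mul_left _).congr_fun fun z => ?_)
    rw [chiProb, pow_add, mul_comm]
  have m1 : ∑' z, chiProb q z * chiTime q z = (1 / 2) ^ q * (S1 + q * S0) := by
    refine HasSum.tsum_eq (((hs1.hasSum.add (hs0.hasSum.mul_left _)).mul_left _).congr_fun
      fun z => ?_)
    rw [chiProb, chiTime, pow_add]
    ring
  have m2 : ∑' z, chiProb q z * chiTime q z * chiTime q z =
      (1 / 2) ^ q * (S2 + 2 * q * S1 + q ^ 2 * S0) := by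
    refine HasSum.tsum_eq ((((hs2.hasSum.add (hs1.hasSum.mul_left _)).add
      (hs0.hasSum.mul_left _)).mul_left _).congr_fun fun z => ?_)
    rw [chiProb, chiTime, pow_add]
    ring
  set h : ℝ := (1 / 2) ^ q with hh
  have hg : (2 : ℝ) ^ q * h = 1 := by rw [hh, ← mul_pow]; norm_num
  have h2q : (2 : ℝ) ^ (2 * q + 1) = 2 * (2 ^ q) ^ 2 := by rw [pow_succ, mul_comm 2 q, pow_mul]; ring
  rw [m0, m1, m2, h2q]
  set g : ℝ := 2 ^ q with hgdef
  have a0 : h * S0 = 1 := by linarith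
  have b0 : S0 = g := by linear_combination g * a0 - S0 * hg
  have a1 : h * S1 = (2 - (q + 2) * h) * S0 := by linarith
  have a2 : h * S2 = 2 * (2 - (q + 2) * h) * S1 + (6 - (q ^ 2 + 4 * q + 6) * h) * S0 := by linarith
  have c1 : h * S1 = 2 * g - (q + 2) := by
    rw [a1, b0]; linear_combination (-(q + 2 : ℝ)) * hg
  have b1 : S1 = 2 * g ^ 2 - (q + 2) * g := by linear_combination g * c1 - S1 * hg
  refine ⟨a0, ?_, ?_⟩
  · linear_combination c1 + q * a0
  · rw [mul_add, mul_add, a2]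
    have e3 : h * (2 * q * S1) = 2 * q * (2 * g - (q + 2)) := by linear_combination 2 * q * c1
    have e4 : h * (q ^ 2 * S0) = q ^ 2 := by linear_combination (q : ℝ) ^ 2 * a0
    have e5 : 2 * (2 - (q + 2) * h) * S1 = 4 * S1 - 2 * (q + 2) * (2 * g - (q + 2)) := by
      linear_combination (-2 * (q + 2 : ℝ)) * c1
    have e6 : (6 - (q ^ 2 + 4 * q + 6) * h) * S0 = 6 * g - (q ^ 2 + 4 * q + 6) := by
      rw [b0]; linear_combination (-(q ^ 2 + 4 * q + 6 : ℝ)) * hg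
    rw [e3, e4, e5, e6, b1]
    ring

/-! ### Entry sums, word products and the rank one factor -/

section Matrices

variable {m : ℕ}

/-- The sum of the absolute values of the entries. -/
noncomputable def entrySum (A : Matrix (Fin m) (Fin m) ℝ) : ℝ := ∑ i, ∑ j, |A i j|

theorem abs_le_entrySum (A : Matrix (Fin m) (Fin m) ℝ) (i j : Fin m) : |A i j| ≤ entrySum A :=
  (Finset.single_le_sum (f := fun j => |A i j|) (fun _ _ => abs_nonneg _)
    (Finset.mem_univ j)).trans
    (Finset.single_le_sum (f := fun i => ∑ j, |A i j|)
      (fun _ _ => Finset.sum_nonneg fun _ _ => abs_nonneg _) (Finset.mem_univ i))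

theorem entrySum_nonneg (A : Matrix (Fin m) (Fin m) ℝ) : 0 ≤ entrySum A :=
  Finset.sum_nonneg fun _ _ => Finset.sum_nonneg fun _ _ => abs_nonneg _

theorem entrySum_pos {A : Matrix (Fin m) (Fin m) ℝ} (hA : A ≠ 0) : 0 < entrySum A := by
  by_contra h
  refine hA (Matrix.ext fun i j => ?_)
  have := abs_le_entrySum A i j
  exact abs_nonpos_iff.1 (this.trans (not_lt.1 h))

theorem entrySum_smul (c : ℝ) (A : Matrix (Fin m) (Fin m) ℝ) :
    entrySum (c • A) = |c| * entrySum A := by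
  simp [entrySum, abs_mul, Finset.mul_sum]

theorem entrySum_vecMulVec (x y : Fin m → ℝ) :
    entrySum (Matrix.vecMulVec x y) = (∑ i, |x i|) * ∑ j, |y j| := by
  simp [entrySum, Matrix.vecMulVec_apply, abs_mul, Finset.sum_mul_sum]

theorem entrySum_mul_le (A B : Matrix (Fin m) (Fin m) ℝ) :
    entrySum (A * B) ≤ entrySum A * entrySum B := by
  calc entrySum (A * B) ≤ ∑ i, ∑ j, ∑ l, |A i l| * |B l j| := by
        refine Finset.sum_le_sum fun i _ => Finset.sum_le_sum fun j _ => ?_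
        rw [Matrix.mul_apply]
        refine (Finset.abs_sum_le_sum_abs _ _).trans_eq ?_
        simp [abs_mul]
    _ = ∑ i, ∑ l, |A i l| * ∑ j, |B l j| := by
        refine Finset.sum_congr rfl fun i _ => ?_
        rw [Finset.sum_comm]
        simp [Finset.mul_sum]
    _ ≤ ∑ i, ∑ l, |A i l| * entrySum B := by
        refine Finset.sum_le_sum fun i _ => Finset.sum_le_sum fun l _ => ?_
        refine mul_le_mul_of_nonneg_left ?_ (abs_nonneg _)
        exact Finset.single_le_sum (f := fun i => ∑ j, |B i j|)
          (fun _ _ => Finset.sum_nonneg fun _ _ => abs_nonneg _) (Finset.mem_univ l)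
    _ = entrySum A * entrySum B := by simp [entrySum, Finset.sum_mul]

/-- The entry sum of a rank one matrix `x yᵀ` is the product of the `ℓ¹` norms of `x` and `y`. This
exact factorization is the reason for working with `entrySum` rather than with the given norm. -/
theorem entrySum_mul_vecMulVec_mul (A B : Matrix (Fin m) (Fin m) ℝ) (u v : Fin m → ℝ) :
    entrySum (A * Matrix.vecMulVec u v * B) * entrySum (Matrix.vecMulVec u v) =
      entrySum (A * Matrix.vecMulVec u v) * entrySum (Matrix.vecMulVec u v * B) := by
  rw [Matrix.mul_vecMulVec, Matrix.vecMulVec_mul, Matrix.vecMulVec_mul, entrySum_vecMulVec,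
    entrySum_vecMulVec, entrySum_vecMulVec, entrySum_vecMulVec]
  ring

/-- A definite seminorm on matrices is equivalent to the entry sum. -/
theorem exists_seminorm_equiv_entrySum (N : Seminorm ℝ (Matrix (Fin m) (Fin m) ℝ))
    (hN : ∀ A, N A = 0 → A = 0) :
    ∃ c C : ℝ, 0 < c ∧ 0 < C ∧ ∀ A, c * entrySum A ≤ N A ∧ N A ≤ C * entrySum A := by
  have hup : ∃ C : ℝ, 0 < C ∧ ∀ A, N A ≤ C * entrySum A := by
    refine ⟨1 + ∑ i, ∑ j, N (Matrix.single i j 1), ?_, fun A => ?_⟩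
    · have : 0 ≤ ∑ i : Fin m, ∑ j : Fin m, N (Matrix.single i j 1) :=
        Finset.sum_nonneg fun _ _ => Finset.sum_nonneg fun _ _ => apply_nonneg N _
      linarith
    · have h1 : N A ≤ ∑ i, ∑ j, |A i j| * N (Matrix.single i j 1) := by
        conv_lhs => rw [Matrix.matrix_eq_sum_single A]
        refine (Finset.le_sum_of_subadditive N (map_zero N).le (map_add_le_add N) _ _).trans (Finset.sum_le_sum fun i _ => ?_)
        refine (Finset.le_sum_of_subadditive N (map_zero N).le (map_add_le_add N) _ _).trans (Finset.sum_le_sum fun j _ => ?_)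
        rw [← Real.norm_eq_abs, ← map_smul_eq_mul, Matrix.smul_single, smul_eq_mul, mul_one]
      refine h1.trans ?_
      have h2 : ∑ i, ∑ j, |A i j| * N (Matrix.single i j 1) ≤
          ∑ i, ∑ j, entrySum A * N (Matrix.single i j 1) := by
        gcongr with i _ j _
        exact abs_le_entrySum A i j
      refine h2.trans ?_
      simp_rw [← Finset.mul_sum]
      have := entrySum_nonneg A
      linarith
  obtain ⟨C, hC, hCN⟩ := hup
  -- The sup norm serves only as a reference norm, for the compactness of the entry sum sphere.
  let := Matrix.normedAddCommGroup (m := Fin m) (n := Fin m) (α := ℝ)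
  let : NormedSpace ℝ (Matrix (Fin m) (Fin m) ℝ) := Matrix.normedSpace
  have hE : Continuous (entrySum : Matrix (Fin m) (Fin m) ℝ → ℝ) := by
    unfold entrySum
    fun_prop
  have hNc : Continuous N := by
    refine continuous_iff_continuousAt.2 fun A => ?_
    have h0 : Tendsto (fun B => C * entrySum (B - A)) (𝓝 A) (𝓝 0) := by
      have : Continuous fun B => C * entrySum (B - A) := by
        exact continuous_const.mul (hE.comp (continuous_id.sub continuous_const))
      simpa [entrySum] using this.tendsto A
    refine tendsto_iff_dist_tendsto_zero.2 (squeeze_zero (fun _ => dist_nonneg) (fun B => ?_) h0)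
    exact (abs_sub_map_le_sub N B A).trans (hCN _)
  have hcomp : IsCompact {A : Matrix (Fin m) (Fin m) ℝ | entrySum A = 1} := by
    have : ProperSpace (Matrix (Fin m) (Fin m) ℝ) := FiniteDimensional.proper_real _
    refine Metric.isCompact_of_isClosed_isBounded (isClosed_eq hE continuous_const) ?_
    refine isBounded_iff_forall_norm_le.2 ⟨1, fun A hA => ?_⟩
    refine (Matrix.norm_le_iff zero_le_one).2 fun i j => ?_
    exact (abs_le_entrySum A i j).trans_eq hA
  have hlow : ∃ c : ℝ, 0 < c ∧ ∀ A, entrySum A = 1 → c ≤ N A := by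
    -- The sphere is empty when `m = 0`.
    rcases Set.eq_empty_or_nonempty {A : Matrix (Fin m) (Fin m) ℝ | entrySum A = 1} with he | hne
    · exact ⟨1, one_pos, fun A hA => (Set.eq_empty_iff_forall_notMem.1 he A hA).elim⟩
    · obtain ⟨A₀, hA₀, hmin⟩ := hcomp.exists_isMinOn hne hNc.continuousOn
      refine ⟨N A₀, (apply_nonneg N _).lt_of_ne fun h => ?_, fun A hA => hmin hA⟩
      rw [hN A₀ h.symm] at hA₀
      simp [entrySum] at hA₀
  obtain ⟨c, hc, hcN⟩ := hlow
  refine ⟨c, C, hc, hC, fun A => ⟨?_, hCN A⟩⟩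
  by_cases hA : A = 0
  · simp [hA, entrySum]
  have hpos := entrySum_pos hA
  have h1 := hcN ((entrySum A)⁻¹ • A) (by
    rw [entrySum_smul, abs_of_pos (inv_pos.2 hpos), inv_mul_cancel₀ hpos.ne'])
  rw [map_smul_eq_mul, Real.norm_of_nonneg (inv_pos.2 hpos).le, inv_mul_eq_div,
    le_div_iff₀ hpos] at h1
  exact h1

variable (D : Fin 2 → Matrix (Fin m) (Fin m) ℝ)

theorem wordProd_cons (a : Fin 2) (w : List (Fin 2)) :
    wordProd D (a :: w) = D a * wordProd D w := by simp [wordProd]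

theorem wordProd_append (w w' : List (Fin 2)) :
    wordProd D (w ++ w') = wordProd D w * wordProd D w' := by simp [wordProd]

theorem wordProd_replicate (n : ℕ) (a : Fin 2) : wordProd D (List.replicate n a) = D a ^ n := by
  simp [wordProd]

theorem wordProd_conjMat {Q : Matrix (Fin m) (Fin m) ℝ} (hQ : IsUnit Q) (z : List (Fin 2)) :
    wordProd (conjMat Q D) z = Q⁻¹ * wordProd D z * Q := by
  have hdet := (Matrix.isUnit_iff_isUnit_det Q).1 hQ
  induction z with
  | nil => simp [wordProd, Matrix.nonsing_inv_mul Q hdet]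
  | cons a z ih =>
    rw [wordProd_cons, wordProd_cons, ih, conjMat]
    simp only [Matrix.mul_assoc]
    rw [← Matrix.mul_assoc Q Q⁻¹, Matrix.mul_nonsing_inv Q hdet, Matrix.one_mul]

variable {D}

/-- The nonzero entries of products of nonnegative matrices decay at most exponentially. -/
theorem exists_entry_lower_bound (hD : ∀ a i j, 0 ≤ D a i j) :
    ∃ δ : ℝ, 0 < δ ∧ δ ≤ 1 ∧ ∀ w i j, 0 ≤ wordProd D w i j ∧
      (wordProd D w i j ≠ 0 → δ ^ w.length ≤ wordProd D w i j) := by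
  obtain ⟨δ, hδ, hδ1, hδD⟩ : ∃ δ : ℝ, 0 < δ ∧ δ ≤ 1 ∧ ∀ a i j, D a i j ≠ 0 → δ ≤ D a i j := by
    -- Zero entries are replaced by 1 so that the minimum is positive; inserting 1 makes the set
    -- nonempty and gives `δ ≤ 1`.
    let s : Finset ℝ := (Finset.univ.image fun x : Fin 2 × Fin m × Fin m =>
      if D x.1 x.2.1 x.2.2 = 0 then 1 else D x.1 x.2.1 x.2.2)
    have hs : (insert 1 s).Nonempty := Finset.insert_nonempty _ _
    refine ⟨(insert 1 s).min' hs, ?_, Finset.min'_le _ _ (by simp), fun a i j h => ?_⟩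
    · rw [Finset.lt_min'_iff]
      intro y hy
      rcases Finset.mem_insert.1 hy with rfl | hy
      · exact one_pos
      · obtain ⟨x, -, rfl⟩ := Finset.mem_image.1 hy
        split_ifs with h
        · exact one_pos
        · exact (hD _ _ _).lt_of_ne (Ne.symm h)
    · refine Finset.min'_le _ _ (Finset.mem_insert_of_mem (Finset.mem_image.2
        ⟨(a, i, j), Finset.mem_univ _, by simp [h]⟩))
  refine ⟨δ, hδ, hδ1, fun w => ?_⟩
  induction w with
  | nil =>
    intro i j
    by_cases h : i = j <;> simp [wordProd, h]
  | cons a w ih =>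
    intro i j
    rw [wordProd_cons, Matrix.mul_apply]
    have hnn : ∀ l ∈ Finset.univ, 0 ≤ D a i l * wordProd D w l j :=
      fun l _ => mul_nonneg (hD _ _ _) (ih l j).1
    refine ⟨Finset.sum_nonneg hnn, fun h => ?_⟩
    obtain ⟨l, -, hl⟩ := Finset.exists_ne_zero_of_sum_ne_zero h
    refine le_trans ?_ (Finset.single_le_sum hnn (Finset.mem_univ l))
    rw [List.length_cons, pow_succ']
    exact mul_le_mul (hδD _ _ _ (left_ne_zero_of_mul hl)) ((ih l j).2 (right_ne_zero_of_mul hl))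
      (by positivity) (hD _ _ _)

/-- The upper bound is submultiplicativity. The lower bound needs nonnegativity: without
cancellation, a nonzero product has an entry at least `δ ^ length`. -/
theorem exists_abs_log_entrySum_le (hD : ∀ a i j, 0 ≤ D a i j) (hD_ne : ∀ z, wordProd D z ≠ 0) :
    ∃ R : ℝ, 0 ≤ R ∧ ∀ w, |Real.log (entrySum (wordProd D w))| ≤ R * (w.length + 1) := by
  obtain ⟨δ, hδ, hδ1, hδD⟩ := exists_entry_lower_bound hD
  obtain ⟨C, hC1, hC0, hCD⟩ : ∃ C : ℝ, 1 ≤ C ∧ entrySum (1 : Matrix (Fin m) (Fin m) ℝ) ≤ C ∧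
      ∀ a, entrySum (D a) ≤ C := by
    have h0 := entrySum_nonneg (1 : Matrix (Fin m) (Fin m) ℝ)
    have h1 := entrySum_nonneg (D 0)
    have h2 := entrySum_nonneg (D 1)
    refine ⟨1 + entrySum (1 : Matrix (Fin m) (Fin m) ℝ) + entrySum (D 0) + entrySum (D 1),
      by linarith, by linarith, fun a => ?_⟩
    fin_cases a <;> simp <;> linarith
  have hup : ∀ w, entrySum (wordProd D w) ≤ C ^ (w.length + 1) := by
    intro w
    induction w with
    | nil => simpa [wordProd] using hC0
    | cons a w ih =>
      rw [wordProd_cons, List.length_cons, pow_succ' C (w.length + 1)]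
      exact (entrySum_mul_le _ _).trans (mul_le_mul (hCD a) ih (entrySum_nonneg _) (by linarith))
  have hlow : ∀ w, δ ^ w.length ≤ entrySum (wordProd D w) := by
    intro w
    obtain ⟨i, j, hij⟩ : ∃ i j, wordProd D w i j ≠ 0 := by
      by_contra! h
      exact hD_ne w (Matrix.ext h)
    exact ((hδD w i j).2 hij).trans ((le_abs_self _).trans (abs_le_entrySum _ i j))
  have hlC : 0 ≤ Real.log C := Real.log_nonneg hC1
  have hlδ : Real.log δ ≤ 0 := Real.log_nonpos hδ.le hδ1
  refine ⟨Real.log C - Real.log δ, by linarith, fun w => abs_le.2 ⟨?_, ?_⟩⟩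
  · have := Real.log_le_log (by positivity) (hlow w)
    rw [Real.log_pow] at this
    have h3 : 0 ≤ (w.length : ℝ) := Nat.cast_nonneg _
    nlinarith
  · have := Real.log_le_log (entrySum_pos (hD_ne w)) (hup w)
    rw [Real.log_pow] at this
    push_cast at this
    have h3 : 0 ≤ (w.length : ℝ) := Nat.cast_nonneg _
    nlinarith

variable [NeZero m] {Q : Matrix (Fin m) (Fin m) ℝ} {q : ℕ}

theorem pow_eq_vecMulVec (hQ : IsUnit Q) (hQD : Q⁻¹ * D 0 ^ q * Q = Matrix.single 0 0 1) :
    D 0 ^ q = Matrix.vecMulVec (fun i => Q i 0) (fun j => Q⁻¹ 0 j) := by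
  have hdet := (Matrix.isUnit_iff_isUnit_det Q).1 hQ
  have h : D 0 ^ q = Q * Matrix.single 0 0 1 * Q⁻¹ := by
    rw [← hQD, ← Matrix.mul_assoc, ← Matrix.mul_assoc, Matrix.mul_nonsing_inv Q hdet,
      Matrix.one_mul, Matrix.mul_assoc, Matrix.mul_nonsing_inv Q hdet, Matrix.mul_one]
  rw [h]
  ext i j
  simp [Matrix.mul_apply, Matrix.single_apply, Matrix.vecMulVec_apply, ite_and]

/-- With `P = u vᵀ`, where `u` is the first column of `Q` and `vᵀ` the first row of `Q⁻¹`, one has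
`P M P = (vᵀ M u) P`, and `vᵀ M u` is the corner entry of `Q⁻¹ M Q`. -/
theorem zeros_mul_mul_zeros (hQ : IsUnit Q) (hQD : Q⁻¹ * D 0 ^ q * Q = Matrix.single 0 0 1)
    (z : List (Fin 2)) :
    D 0 ^ q * wordProd D z * D 0 ^ q = wordProd (conjMat Q D) z 0 0 • D 0 ^ q := by
  rw [pow_eq_vecMulVec hQ hQD, wordProd_conjMat D hQ, Matrix.vecMulVec_mul,
    Matrix.vecMulVec_mul_vecMulVec]
  ext i j
  have : (Q⁻¹ * wordProd D z * Q) 0 0 =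
      dotProduct (Matrix.vecMul (fun j => Q⁻¹ 0 j) (wordProd D z)) fun i => Q i 0 := by
    simp [Matrix.mul_apply, dotProduct, Matrix.vecMul]
  simp only [this, Matrix.vecMulVec_apply, Matrix.smul_apply, Pi.smul_apply, smul_eq_mul]
  ring

end Matrices

/-! ### Moment exponents, generating series and the renewal equation -/

section WordSeries

variable {A F G : List (Fin 2) → ℝ} {R : ℝ} {q : ℕ}

/-- The expectation of `exp (t A(z₀ ⋯ z_{k-1}))` for `k` fair coin tosses. -/
noncomputable def wordMoment (A : List (Fin 2) → ℝ) (t : ℝ) (k : ℕ) : ℝ :=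
  (∑ z : Fin k → Fin 2, Real.exp (t * A (List.ofFn z))) / 2 ^ k

/-- The generating series of `wordMoment A t` at `exp (-s)`, as a sum over words. -/
noncomputable def wordSeries (A : List (Fin 2) → ℝ) (t s : ℝ) : ℝ≥0∞ :=
  ∑' w : List (Fin 2), ENNReal.ofReal ((1 / 2) ^ w.length * Real.exp (t * A w - s * w.length))

theorem wordMoment_pos (A : List (Fin 2) → ℝ) (t : ℝ) (k : ℕ) : 0 < wordMoment A t k :=
  div_pos (Finset.sum_pos (fun _ _ => Real.exp_pos _) Finset.univ_nonempty) (by positivity)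

theorem wordSeries_eq_tsum_wordMoment (A : List (Fin 2) → ℝ) (t s : ℝ) :
    wordSeries A t s = ∑' k : ℕ, ENNReal.ofReal (wordMoment A t k * Real.exp (-s * k)) := by
  rw [wordSeries, ← List.equivSigmaTuple.symm.tsum_eq, ENNReal.tsum_sigma']
  refine tsum_congr fun k => ?_
  rw [tsum_fintype, ← ENNReal.ofReal_sum_of_nonneg fun _ _ => by positivity]
  congr 1
  rw [wordMoment, div_mul_eq_mul_div, Finset.sum_mul, Finset.sum_div]
  refine Finset.sum_congr rfl fun z _ => ?_
  simp only [List.equivSigmaTuple, Equiv.coe_fn_symm_mk, List.length_ofFn]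
  rw [← Real.exp_add, one_div, inv_pow, inv_mul_eq_div]
  congr 2
  ring

theorem sum_append (f : List (Fin 2) → ℝ) (j k : ℕ) :
    ∑ z : Fin (j + k) → Fin 2, f (List.ofFn z) =
      ∑ x : Fin j → Fin 2, ∑ y : Fin k → Fin 2, f (List.ofFn x ++ List.ofFn y) := by
  rw [← Fintype.sum_prod_type', ← (Fin.appendEquiv j k).sum_comp]
  refine Finset.sum_congr rfl fun z _ => ?_
  rw [← List.ofFn_fin_append]
  rfl

theorem wordMoment_mul (A : List (Fin 2) → ℝ) (t : ℝ) (j k : ℕ) :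
    wordMoment A t j * wordMoment A t k = (∑ x : Fin j → Fin 2, ∑ y : Fin k → Fin 2,
      Real.exp (t * (A (List.ofFn x) + A (List.ofFn y)))) / 2 ^ (j + k) := by
  rw [wordMoment, wordMoment, div_mul_div_comm, Finset.sum_mul_sum, pow_add]
  simp_rw [mul_add, Real.exp_add]

theorem wordMoment_le_exp {t c : ℝ} {k : ℕ} (h : ∀ w : List (Fin 2), w.length = k → t * A w ≤ c) :
    wordMoment A t k ≤ Real.exp c := by
  rw [wordMoment, div_le_iff₀ (by positivity)]
  refine (Finset.sum_le_card_nsmul _ _ (Real.exp c) fun z _ =>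
    Real.exp_le_exp.2 (h _ (List.length_ofFn))).trans_eq ?_
  simp [mul_comm]

theorem exp_le_wordMoment {t c : ℝ} {k : ℕ} (h : ∀ w : List (Fin 2), w.length = k → c ≤ t * A w) :
    Real.exp c ≤ wordMoment A t k := by
  rw [wordMoment, le_div_iff₀ (by positivity)]
  refine Eq.trans_le ?_ (Finset.card_nsmul_le_sum _ _ (Real.exp c) fun z _ =>
    Real.exp_le_exp.2 (h _ (List.length_ofFn)))
  simp [mul_comm]

theorem abs_log_wordMoment_le (hA : ∀ w, |A w| ≤ R * (w.length + 1)) (t : ℝ) (k : ℕ) :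
    |Real.log (wordMoment A t k)| ≤ |t| * R * (k + 1) := by
  have h : ∀ w : List (Fin 2), w.length = k → |t * A w| ≤ |t| * R * (k + 1) := by
    rintro w rfl
    rw [abs_mul, mul_assoc]
    gcongr
    exact hA w
  refine abs_le.2 ⟨?_, ?_⟩
  · rw [Real.le_log_iff_exp_le (wordMoment_pos _ _ _)]
    exact exp_le_wordMoment fun w hw => (abs_le.1 (h w hw)).1
  · rw [Real.log_le_iff_le_exp (wordMoment_pos _ _ _)]
    exact wordMoment_le_exp fun w hw => (abs_le.1 (h w hw)).2

theorem Subadditive.exists_tendsto_of_abs_le {u : ℕ → ℝ} (hu : Subadditive u) {C : ℝ}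
    (hC : ∀ k, |u k| ≤ C * (k + 1)) : ∃ l, Tendsto (fun k => u k / k) atTop (𝓝 l) := by
  have hC0 : 0 ≤ C := by simpa using (abs_nonneg _).trans (hC 0)
  -- For `k ≥ 1`, `C (k + 1) ≤ 2 C k`; at `k = 0` the quotient is 0 by convention.
  refine ⟨_, hu.tendsto_lim ⟨-(2 * C), ?_⟩⟩
  rintro _ ⟨k, rfl⟩
  rcases Nat.eq_zero_or_pos k with rfl | hk
  · simpa using hC0
  · have h1 : (1 : ℝ) ≤ k := by exact_mod_cast hk
    have h2 := (abs_le.1 (hC k)).1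
    change _ ≤ u k / k
    rw [le_div_iff₀ (by linarith)]
    nlinarith

/-- The moment exponent of a subadditive function of linear growth exists. -/
theorem exists_tendsto_log_wordMoment (hsub : ∀ x y, A (x ++ y) ≤ A x + A y)
    (hA : ∀ w, |A w| ≤ R * (w.length + 1)) (t : ℝ) :
    ∃ l, Tendsto (fun k : ℕ => Real.log (wordMoment A t k) / k) atTop (𝓝 l) := by
  -- Multiplication by `t ≤ 0` reverses the inequality for `A`, so the log moments are then
  -- superadditive.
  rcases le_total 0 t with ht | ht
  · have hu : Subadditive fun k => Real.log (wordMoment A t k) := by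
      intro j k
      rw [← Real.log_mul (wordMoment_pos _ _ _).ne' (wordMoment_pos _ _ _).ne', wordMoment_mul]
      refine Real.log_le_log (wordMoment_pos _ _ _) ?_
      rw [wordMoment, sum_append fun w => Real.exp (t * A w)]
      gcongr
      exact hsub _ _
    exact hu.exists_tendsto_of_abs_le (abs_log_wordMoment_le hA t)
  · have hu : Subadditive fun k => -Real.log (wordMoment A t k) := by
      intro j k
      rw [← neg_add, ← Real.log_mul (wordMoment_pos _ _ _).ne' (wordMoment_pos _ _ _).ne']
      refine neg_le_neg (Real.log_le_log (mul_pos (wordMoment_pos _ _ _)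
        (wordMoment_pos _ _ _)) ?_)
      rw [wordMoment_mul, wordMoment, sum_append fun w => Real.exp (t * A w)]
      gcongr ?_ / _
      refine Finset.sum_le_sum fun x _ => Finset.sum_le_sum fun y _ => ?_
      exact Real.exp_le_exp.2 (mul_le_mul_of_nonpos_left (hsub _ _) ht)
    obtain ⟨l, hl⟩ := hu.exists_tendsto_of_abs_le
      (fun k => by rw [abs_neg]; exact abs_log_wordMoment_le hA t k)
    refine ⟨-l, hl.neg.congr fun k => by ring⟩

/-- The terms of a convergent series tend to 0, so the `k`-th moment is eventually below `exp (s
k)`. Together with the converse by comparison with a geometric series, this makes `l` the abscissa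
of convergence. -/
theorem le_of_wordSeries_ne_top {t s l : ℝ}
    (hl : Tendsto (fun k : ℕ => Real.log (wordMoment A t k) / k) atTop (𝓝 l))
    (h : wordSeries A t s ≠ ⊤) : l ≤ s := by
  rw [wordSeries_eq_tsum_wordMoment] at h
  refine le_of_tendsto hl ?_
  have h0 := (ENNReal.tendsto_cofinite_zero_of_tsum_ne_top h).eventually
    (gt_mem_nhds (zero_lt_one (α := ℝ≥0∞)))
  rw [Nat.cofinite_eq_atTop] at h0
  filter_upwards [h0, eventually_gt_atTop 0] with k hk hk0
  have hk0' : (0 : ℝ) < k := by exact_mod_cast hk0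
  rw [← ENNReal.ofReal_one, ENNReal.ofReal_lt_ofReal_iff one_pos, neg_mul, Real.exp_neg,
    ← div_eq_mul_inv, div_lt_one (Real.exp_pos _)] at hk
  rw [div_le_iff₀ hk0', Real.log_le_iff_le_exp (wordMoment_pos _ _ _)]
  exact hk.le

theorem le_of_wordSeries_eq_top {t s l : ℝ}
    (hl : Tendsto (fun k : ℕ => Real.log (wordMoment A t k) / k) atTop (𝓝 l))
    (h : wordSeries A t s = ⊤) : s ≤ l := by
  by_contra! hlt
  obtain ⟨r, hlr, hrs⟩ := exists_between hlt
  have hs : Summable fun k : ℕ => wordMoment A t k * Real.exp (-s * k) := by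
    have hg : Summable fun k : ℕ => Real.exp (r - s) ^ k :=
      summable_geometric_of_lt_one (Real.exp_pos _).le (by simpa using hrs)
    refine Summable.of_norm_bounded_eventually_nat hg ?_
    filter_upwards [hl.eventually_lt_const hlr, eventually_gt_atTop 0] with k hk hk0
    have hk0' : (0 : ℝ) < k := by exact_mod_cast hk0
    rw [div_lt_iff₀ hk0', Real.log_lt_iff_lt_exp (wordMoment_pos _ _ _)] at hk
    rw [Real.norm_of_nonneg (mul_nonneg (wordMoment_pos _ _ _).le (Real.exp_pos _).le),
      ← Real.exp_nat_mul]
    calc wordMoment A t k * Real.exp (-s * k) ≤ Real.exp (r * k) * Real.exp (-s * k) := by gcongr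
      _ = _ := by rw [← Real.exp_add]; congr 1; ring
  rw [wordSeries_eq_tsum_wordMoment] at h
  exact hs.tsum_ofReal_ne_top h

/-- The contribution to `wordSeries` of the words without `q` consecutive zeros. -/
noncomputable def noZeroRunSeries (q : ℕ) (F : List (Fin 2) → ℝ) (t s : ℝ) : ℝ≥0∞ :=
  ∑' w : noZeroRun q, ENNReal.ofReal ((1 / 2) ^ (w : List (Fin 2)).length *
    Real.exp (t * F w - s * (w : List (Fin 2)).length))

/-- The sum of `exp (t Y - s τ)` over the first occurrences of `q` consecutive zeros. -/
noncomputable def chiSeries (q : ℕ) (Y : chi q → ℝ) (t s : ℝ) : ℝ≥0∞ :=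
  ∑' z : chi q, ENNReal.ofReal (chiProb q z * Real.exp (t * Y z - s * chiTime q z))

/-- `F` and `G` are kept apart to cover both the pure renewal equation (`F = G`) and the delayed
one, in which the first block carries a different weight. -/
theorem renewal_term {Y : chi q → ℝ} (hF : ∀ (z : chi q) y,
      F ((z : List (Fin 2)) ++ (List.replicate q 0 ++ y)) = Y z + G y) (t s : ℝ)
    (z : chi q) (y : List (Fin 2)) :
    ENNReal.ofReal ((1 / 2) ^ ((z : List (Fin 2)) ++ (List.replicate q 0 ++ y)).length *
      Real.exp (t * F ((z : List (Fin 2)) ++ (List.replicate q 0 ++ y)) -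
        s * ((z : List (Fin 2)) ++ (List.replicate q 0 ++ y)).length)) =
    ENNReal.ofReal (chiProb q z * Real.exp (t * Y z - s * chiTime q z)) *
      ENNReal.ofReal ((1 / 2) ^ y.length * Real.exp (t * G y - s * y.length)) := by
  rw [← ENNReal.ofReal_mul (by unfold chiProb; positivity), hF]
  congr 1
  have h : t * (Y z + G y) - s * ((z : List (Fin 2)) ++ (List.replicate q 0 ++ y)).length =
      (t * Y z - s * chiTime q z) + (t * G y - s * y.length) := by
    simp only [List.length_append, List.length_replicate, chiTime]
    push_cast
    ring
  rw [h, Real.exp_add, chiProb]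
  simp only [List.length_append, List.length_replicate, pow_add]
  ring

/-- The renewal equation. -/
theorem wordSeries_renewal (hq : 1 ≤ q) {Y : chi q → ℝ} (hF : ∀ (z : chi q) y,
      F ((z : List (Fin 2)) ++ (List.replicate q 0 ++ y)) = Y z + G y) (t s : ℝ) :
    wordSeries F t s = noZeroRunSeries q F t s + chiSeries q Y t s * wordSeries G t s := by
  rw [wordSeries, tsum_words_eq hq, chiSeries, ← ENNReal.tsum_mul_right]
  congr 1
  refine tsum_congr fun z => ?_
  rw [wordSeries, ← ENNReal.tsum_mul_left]
  exact tsum_congr fun y => renewal_term hF t s z y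

/-- A finite solution of `W = N + c W` with `c ≥ 1` forces `N = 0`, but the empty word contributes
to `N`. -/
theorem wordSeries_eq_top (hq : 1 ≤ q) {X : chi q → ℝ} (hG : ∀ (z : chi q) y,
      G ((z : List (Fin 2)) ++ (List.replicate q 0 ++ y)) = X z + G y) {t s : ℝ}
    (h : 1 ≤ chiSeries q X t s) : wordSeries G t s = ⊤ := by
  by_contra hne
  have h1 := wordSeries_renewal hq hG t s
  have h2 : wordSeries G t s ≤ chiSeries q X t s * wordSeries G t s := le_mul_of_one_le_left' h
  have h3 : noZeroRunSeries q G t s ≠ 0 := by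
    have h4 := ENNReal.le_tsum (f := fun w : noZeroRun q => ENNReal.ofReal ((1 / 2) ^
      (w : List (Fin 2)).length * Real.exp (t * G w - s * (w : List (Fin 2)).length)))
      ⟨[], (nil_mem_chi hq).1⟩
    refine (lt_of_lt_of_le ?_ h4).ne'
    rw [ENNReal.ofReal_pos]
    positivity
  have h5 : noZeroRunSeries q G t s + wordSeries G t s ≤ 0 + wordSeries G t s := by
    rw [zero_add]
    exact (add_le_add_right h2 _).trans_eq h1.symm
  exact h3 (nonpos_iff_eq_zero.1 ((ENNReal.add_le_add_iff_right hne).1 h5))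

/-- The renewal equation alone admits `W = ⊤`. It is therefore applied to sums truncated by length:
if `z 0^q y` is short enough, so is `y`. -/
theorem wordSeries_ne_top (hq : 1 ≤ q) {X : chi q → ℝ} (hG : ∀ (z : chi q) y,
      G ((z : List (Fin 2)) ++ (List.replicate q 0 ++ y)) = X z + G y) {t s : ℝ}
    (hN : noZeroRunSeries q G t s ≠ ⊤) (h : chiSeries q X t s < 1) : wordSeries G t s ≠ ⊤ := by
  refine tsum_ne_top_of_truncation List.length hN h (List.finite_length_le (Fin 2))
    (fun _ => ENNReal.ofReal_ne_top) fun n => ?_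
  refine (tsum_words_eq hq _).trans_le ?_
  rw [chiSeries, ← ENNReal.tsum_mul_right]
  refine add_le_add (ENNReal.tsum_le_tsum fun w => Set.indicator_le_self _ _ _)
    (ENNReal.tsum_le_tsum fun z => ?_)
  rw [← ENNReal.tsum_mul_left]
  refine ENNReal.tsum_le_tsum fun y => ?_
  by_cases hy : ((z : List (Fin 2)) ++ (List.replicate q 0 ++ y)).length ≤ n
  · rw [Set.indicator_of_mem (by exact hy), Set.indicator_of_mem, renewal_term hG]
    rw [Set.mem_ofPred_eq]
    simp only [List.length_append] at hy
    omega
  · rw [Set.indicator_of_notMem (by exact hy)]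
    exact zero_le

theorem noZeroRunSeries_ne_top {η : ℝ} (hs : Summable fun w : noZeroRun q =>
      (1 / 2 : ℝ) ^ (w : List (Fin 2)).length * Real.exp (η * (w : List (Fin 2)).length))
    (hF : ∀ w, |F w| ≤ R * (w.length + 1)) {t s : ℝ} (h : |t| * R + |s| ≤ η) :
    noZeroRunSeries q F t s ≠ ⊤ := by
  refine Summable.tsum_ofReal_ne_top ?_
  refine Summable.of_nonneg_of_le (fun _ => by positivity) (fun w => ?_)
    (hs.mul_left (Real.exp (|t| * R)))
  have hl : 0 ≤ ((w : List (Fin 2)).length : ℝ) := Nat.cast_nonneg _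
  have h1 : t * F w - s * (w : List (Fin 2)).length ≤
      |t| * R + η * (w : List (Fin 2)).length := by
    have h2 : t * F w ≤ |t| * (R * ((w : List (Fin 2)).length + 1)) :=
      (le_abs_self _).trans (by rw [abs_mul]; gcongr; exact hF w)
    have h3 := neg_abs_le s
    nlinarith
  calc (1 / 2 : ℝ) ^ (w : List (Fin 2)).length *
        Real.exp (t * F w - s * (w : List (Fin 2)).length)
      ≤ (1 / 2 : ℝ) ^ (w : List (Fin 2)).length *
        Real.exp (|t| * R + η * (w : List (Fin 2)).length) := by gcongr
    _ = _ := by rw [Real.exp_add]; ring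

theorem chiSeries_eq_ofReal {η K : ℝ} (hm : HasTiltedMoments (chiTime q) η (chiProb q))
    (hq : 1 ≤ q) {Y : chi q → ℝ} (hY : ∀ z, |Y z| ≤ K * chiTime q z) (hK : 0 ≤ K) {t s : ℝ}
    (hv : (K + 1) * ‖(t, s)‖ ≤ η) :
    chiSeries q Y t s = ENNReal.ofReal (tiltSum Y (chiTime q) (chiProb q) (t, s)) := by
  rw [chiSeries, tiltSum, ENNReal.ofReal_tsum_of_nonneg]
  · intro z; unfold chiProb; positivity
  · exact hm.summable (one_le_chiTime hq) hY hK hv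

end WordSeries

/-! ### The moment exponent as a solution of the pressure equation -/

section Exponent

variable {A B : List (Fin 2) → ℝ} {C : ℝ}

theorem log_wordMoment_sub_le (h : ∀ w, |B w - A w| ≤ C) (t : ℝ) (k : ℕ) :
    Real.log (wordMoment B t k) - Real.log (wordMoment A t k) ≤ |t| * C := by
  have h1 : wordMoment B t k ≤ Real.exp (|t| * C) * wordMoment A t k := by
    rw [wordMoment, wordMoment, ← mul_div_assoc, Finset.mul_sum]
    gcongr with z
    rw [← Real.exp_add]
    refine Real.exp_le_exp.2 ?_
    have h2 : t * (B (List.ofFn z) - A (List.ofFn z)) ≤ |t| * C :=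
      (le_abs_self _).trans (by rw [abs_mul]; gcongr; exact h _)
    linarith
  have h3 := Real.log_le_log (wordMoment_pos _ _ _) h1
  rw [Real.log_mul (Real.exp_pos _).ne' (wordMoment_pos _ _ _).ne', Real.log_exp] at h3
  linarith

/-- A bounded change of `A` alters the log moment by at most `|t| C`, which vanishes after division
by `k`. This makes the exponent independent of the norm. -/
theorem tendsto_log_wordMoment_of_close (h : ∀ w, |B w - A w| ≤ C) {t l : ℝ}
    (hl : Tendsto (fun k : ℕ => Real.log (wordMoment A t k) / k) atTop (𝓝 l)) :
    Tendsto (fun k : ℕ => Real.log (wordMoment B t k) / k) atTop (𝓝 l) := by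
  have h0 : Tendsto (fun k : ℕ => (Real.log (wordMoment B t k) - Real.log (wordMoment A t k)) / k)
      atTop (𝓝 0) := by
    refine squeeze_zero_norm (fun k => ?_) (tendsto_const_div_atTop_nhds_zero_nat (|t| * C))
    rw [Real.norm_eq_abs, abs_div, Nat.abs_cast]
    gcongr
    refine abs_sub_le_iff.2 ⟨log_wordMoment_sub_le h t k, log_wordMoment_sub_le (fun w => ?_) t k⟩
    rw [abs_sub_comm]
    exact h w
  simpa [← add_div] using h0.add hl

variable {m : ℕ} {D : Fin 2 → Matrix (Fin m) (Fin m) ℝ}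

theorem normMoment_eq_wordMoment {N : Seminorm ℝ (Matrix (Fin m) (Fin m) ℝ)}
    (hpos : ∀ w, 0 < N (wordProd D w)) (t : ℝ) (k : ℕ) :
    normMoment N D t k = wordMoment (fun w => Real.log (N (wordProd D w))) t k := by
  rw [normMoment, wordMoment]
  congr 1
  refine Finset.sum_congr rfl fun z _ => ?_
  rw [Real.rpow_def_of_pos (hpos _), mul_comm]

theorem isMomentLyapunovExponent_of_entrySum {N : Seminorm ℝ (Matrix (Fin m) (Fin m) ℝ)}
    (hN : ∀ A, N A = 0 → A = 0) (hD_ne : ∀ z, wordProd D z ≠ 0) {L : ℝ → ℝ}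
    (hL : ∀ t, Tendsto (fun k : ℕ =>
      Real.log (wordMoment (fun w => Real.log (entrySum (wordProd D w))) t k) / k)
      atTop (𝓝 (L t))) :
    IsMomentLyapunovExponent N D L := by
  obtain ⟨c, C, hc, hC, hcC⟩ := exists_seminorm_equiv_entrySum N hN
  have hpos : ∀ w, 0 < N (wordProd D w) := fun w =>
    (mul_pos hc (entrySum_pos (hD_ne w))).trans_le (hcC _).1
  have hclose : ∀ w, |Real.log (N (wordProd D w)) - Real.log (entrySum (wordProd D w))| ≤
      |Real.log c| + |Real.log C| := by
    intro w
    have he := entrySum_pos (hD_ne w)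
    have h1 := Real.log_le_log (mul_pos hc he) (hcC (wordProd D w)).1
    have h2 := Real.log_le_log (hpos w) (hcC (wordProd D w)).2
    rw [Real.log_mul hc.ne' he.ne'] at h1
    rw [Real.log_mul hC.ne' he.ne'] at h2
    have h3 := neg_abs_le (Real.log c)
    have h4 := le_abs_self (Real.log C)
    have h5 := abs_nonneg (Real.log c)
    have h6 := abs_nonneg (Real.log C)
    exact abs_le.2 ⟨by linarith, by linarith⟩
  intro t
  refine (tendsto_log_wordMoment_of_close hclose (hL t)).congr fun k => ?_
  rw [normMoment_eq_wordMoment hpos, one_div_mul_eq_div]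

theorem tiltSum_lt_tiltSum {ι : Type*} [Nonempty ι] {X τ p : ι → ℝ} {η K : ℝ} (hp : ∀ z, 0 < p z)
    (hpm : HasTiltedMoments τ η p) (hτ : ∀ z, 1 ≤ τ z) (hX : ∀ z, |X z| ≤ K * τ z) (hK : 0 ≤ K)
    {t s s' : ℝ} (hs : (K + 1) * ‖(t, s)‖ ≤ η) (hs' : (K + 1) * ‖(t, s')‖ ≤ η) (h : s < s') :
    tiltSum X τ p (t, s') < tiltSum X τ p (t, s) := by
  have hlt : ∀ z, p z * Real.exp (t * X z - s' * τ z) < p z * Real.exp (t * X z - s * τ z) := by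
    intro z
    have hz : 0 < τ z := zero_lt_one.trans_le (hτ z)
    have := hp z
    gcongr
  exact (hpm.summable hτ hX hK hs').tsum_lt_tsum (i := Classical.arbitrary ι)
    (fun z => (hlt z).le) (hlt _) (hpm.summable hτ hX hK hs)

theorem chiProb_pos {q : ℕ} (z : chi q) : 0 < chiProb q z := by unfold chiProb; positivity

/-- The growth exponent of `A` is the solution of the pressure equation. -/
theorem exponent_eq_of_tiltSum_eq_one {q : ℕ} (hq : 1 ≤ q) {G : List (Fin 2) → ℝ}
    {X H : chi q → ℝ} {η K : ℝ}
    (hs : Summable fun w : noZeroRun q =>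
      (1 / 2 : ℝ) ^ (w : List (Fin 2)).length * Real.exp (η * (w : List (Fin 2)).length))
    (hm : HasTiltedMoments (chiTime q) η (chiProb q)) (hK : 0 ≤ K)
    (hA : ∀ w, |A w| ≤ K * (w.length + 1)) (hG : ∀ w, |G w| ≤ K * (w.length + 1))
    (hX : ∀ z, |X z| ≤ K * chiTime q z) (hH : ∀ z, |H z| ≤ K * chiTime q z)
    (hAH : ∀ (z : chi q) y, A ((z : List (Fin 2)) ++ (List.replicate q 0 ++ y)) = H z + G y)
    (hGX : ∀ (z : chi q) y, G ((z : List (Fin 2)) ++ (List.replicate q 0 ++ y)) = X z + G y)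
    {t s l : ℝ} (hl : Tendsto (fun k : ℕ => Real.log (wordMoment A t k) / k) atTop (𝓝 l))
    (hv : (K + 1) * ‖(t, s)‖ < η) (h1 : tiltSum X (chiTime q) (chiProb q) (t, s) = 1) :
    l = s := by
  have : Nonempty (chi q) := ⟨⟨[], nil_mem_chi hq⟩⟩
  refine le_antisymm ?_ ?_
  -- For `s'` slightly above `s` the pressure sum drops strictly below 1, so the series converges;
  -- then `s'` tends to `s`.
  · have hev : ∀ᶠ s' in 𝓝[>] s, l ≤ s' := by
      have hc : ContinuousAt (fun s' : ℝ => (K + 1) * ‖(t, s')‖) s := by fun_prop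
      filter_upwards [nhdsWithin_le_nhds (hc.eventually_lt_const hv), self_mem_nhdsWithin]
        with s' hv' hss'
      have hsmall : |t| * K + |s'| ≤ η := by
        have e1 : |t| ≤ ‖(t, s')‖ := norm_fst_le (t, s')
        have e2 : |s'| ≤ ‖(t, s')‖ := norm_snd_le (t, s')
        have e3 := mul_le_mul_of_nonneg_right e1 hK
        linarith
      refine le_of_wordSeries_ne_top hl ?_
      rw [wordSeries_renewal hq hAH]
      refine ENNReal.add_ne_top.2 ⟨noZeroRunSeries_ne_top hs hA hsmall, ENNReal.mul_ne_top ?_ ?_⟩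
      · rw [chiSeries_eq_ofReal hm hq hH hK hv'.le]
        exact ENNReal.ofReal_ne_top
      · refine wordSeries_ne_top hq hGX (noZeroRunSeries_ne_top hs hG hsmall) ?_
        rw [chiSeries_eq_ofReal hm hq hX hK hv'.le, ← ENNReal.ofReal_one,
          ENNReal.ofReal_lt_ofReal_iff one_pos, ← h1]
        exact tiltSum_lt_tiltSum chiProb_pos hm (one_le_chiTime hq) hX hK hv.le hv'.le hss'
    exact ge_of_tendsto (tendsto_id.mono_left nhdsWithin_le_nhds) hev
  -- At `s` itself the pressure sum is 1, so the series for `G` diverges, and it enters the series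
  -- for `A` with a nonzero coefficient.
  · refine le_of_wordSeries_eq_top hl ?_
    have hGt : wordSeries G t s = ⊤ := by
      refine wordSeries_eq_top hq hGX ?_
      rw [chiSeries_eq_ofReal hm hq hX hK hv.le, h1, ENNReal.ofReal_one]
    have hH0 : chiSeries q H t s ≠ 0 := by
      refine (lt_of_lt_of_le ?_ (ENNReal.le_tsum ⟨[], nil_mem_chi hq⟩)).ne'
      rw [ENNReal.ofReal_pos]
      exact mul_pos (chiProb_pos _) (Real.exp_pos _)
    rw [wordSeries_renewal hq hAH, hGt, ENNReal.mul_top hH0, add_top]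

end Exponent

/-! ### Additivity of the log entry sum at runs of zeros; the constants -/

section LogEntrySum

variable {m : ℕ} [NeZero m] {D : Fin 2 → Matrix (Fin m) (Fin m) ℝ}
  {Q : Matrix (Fin m) (Fin m) ℝ} {q : ℕ}

/-- The logarithm splits because the corner entry is nonzero; otherwise the whole product would
vanish, against `hD_ne`. -/
theorem log_entrySum_zeros_append (hD_ne : ∀ z, wordProd D z ≠ 0) (hQ : IsUnit Q)
    (hQD : Q⁻¹ * D 0 ^ q * Q = Matrix.single 0 0 1) (z y : List (Fin 2)) :
    Real.log (entrySum (wordProd D (List.replicate q 0 ++ (z ++ (List.replicate q 0 ++ y))))) =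
      logCorner Q D z + Real.log (entrySum (wordProd D (List.replicate q 0 ++ y))) := by
  have h : wordProd D (List.replicate q 0 ++ (z ++ (List.replicate q 0 ++ y))) =
      wordProd (conjMat Q D) z 0 0 • wordProd D (List.replicate q 0 ++ y) := by
    simp only [wordProd_append, wordProd_replicate]
    rw [← Matrix.mul_assoc, ← Matrix.mul_assoc, zeros_mul_mul_zeros hQ hQD, Matrix.smul_mul]
  have hc : wordProd (conjMat Q D) z 0 0 ≠ 0 := by
    intro h0
    rw [h0, zero_smul] at h
    exact hD_ne _ h
  rw [h, entrySum_smul, Real.log_mul (abs_pos.2 hc).ne' (entrySum_pos (hD_ne _)).ne', logCorner]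

theorem log_entrySum_append_zeros_append (hD_ne : ∀ z, wordProd D z ≠ 0) (hQ : IsUnit Q)
    (hQD : Q⁻¹ * D 0 ^ q * Q = Matrix.single 0 0 1) (z y : List (Fin 2)) :
    Real.log (entrySum (wordProd D (z ++ (List.replicate q 0 ++ y)))) =
      (Real.log (entrySum (wordProd D (z ++ List.replicate q 0))) -
        Real.log (entrySum (wordProd D (List.replicate q 0)))) +
        Real.log (entrySum (wordProd D (List.replicate q 0 ++ y))) := by
  have hP := pow_eq_vecMulVec hQ hQD
  have h := entrySum_mul_vecMulVec_mul (wordProd D z) (wordProd D y)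
    (fun i => Q i 0) (fun j => Q⁻¹ 0 j)
  rw [← hP, ← wordProd_replicate D q 0, Matrix.mul_assoc, ← wordProd_append, ← wordProd_append,
    ← wordProd_append] at h
  have h2 := congrArg Real.log h
  rw [Real.log_mul (entrySum_pos (hD_ne _)).ne' (entrySum_pos (hD_ne _)).ne',
    Real.log_mul (entrySum_pos (hD_ne _)).ne' (entrySum_pos (hD_ne _)).ne'] at h2
  linarith

theorem chiProb_mul_eq (z : chi q) (x : ℝ) :
    chiProb q z * x = (1 / 2) ^ q * (1 / 2 ^ (z : List (Fin 2)).length * x) := by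
  rw [chiProb, pow_add, one_div_pow]
  ring

/-- The prefactor is `2^{-q}`, which turns `2^{-|z|}` into `chiProb`, divided by `E τ = 2 (2^q -
1)`. The same holds for `kappa_eq` and `mu_eq`. -/
theorem lam_eq (Q : Matrix (Fin m) (Fin m) ℝ) (D : Fin 2 → Matrix (Fin m) (Fin m) ℝ) (q : ℕ) :
    lam Q D q = (∑' z : chi q, chiProb q z * logCorner Q D z) / (2 * (2 ^ q - 1)) := by
  simp_rw [chiProb_mul_eq, tsum_mul_left]
  rw [lam, pow_succ, one_div_pow]
  simp only [lamTerm]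
  field_simp

theorem kappa_eq (Q : Matrix (Fin m) (Fin m) ℝ) (D : Fin 2 → Matrix (Fin m) (Fin m) ℝ) (q : ℕ) :
    kappa Q D q =
      (∑' z : chi q, chiProb q z * logCorner Q D z * chiTime q z) / (2 * (2 ^ q - 1)) := by
  have h : ∀ z : chi q, chiProb q z * logCorner Q D z * chiTime q z =
      (1 / 2) ^ q * kappaTerm Q D q z := by
    intro z
    rw [mul_assoc, chiProb_mul_eq, kappaTerm, chiTime]
    ring
  simp_rw [h, tsum_mul_left]
  rw [kappa, pow_succ, one_div_pow]
  field_simp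

theorem mu_eq (Q : Matrix (Fin m) (Fin m) ℝ) (D : Fin 2 → Matrix (Fin m) (Fin m) ℝ) (q : ℕ) :
    mu Q D q =
      (∑' z : chi q, chiProb q z * logCorner Q D z * logCorner Q D z) / (2 * (2 ^ q - 1)) := by
  have h : ∀ z : chi q, chiProb q z * logCorner Q D z * logCorner Q D z =
      (1 / 2) ^ q * muTerm Q D z := by
    intro z
    rw [mul_assoc, chiProb_mul_eq, muTerm]
    ring
  simp_rw [h, tsum_mul_left]
  rw [mu, pow_succ, one_div_pow]
  field_simp

theorem HasTiltedMoments.summable_self {ι : Type*} {τ a : ι → ℝ} {η : ℝ}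
    (ha : HasTiltedMoments τ η a) (hτ : ∀ z, 1 ≤ τ z) (hη : 0 ≤ η) : Summable a := by
  simpa using ha.summable (X := 0) (K := 0) (v := 0) hτ (by simp) le_rfl (by simpa using hη)

theorem summable_terms {η K : ℝ} (hq : 1 ≤ q) (hη : 0 ≤ η)
    (hm : HasTiltedMoments (chiTime q) η (chiProb q))
    (hX : ∀ z : chi q, |logCorner Q D z| ≤ K * chiTime q z) :
    Summable (fun z : chi q => lamTerm Q D z) ∧ Summable (fun z : chi q => kappaTerm Q D q z) ∧
      Summable (fun z : chi q => muTerm Q D z) := by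
  have hτ := one_le_chiTime hq
  have hτ0 : ∀ z, |chiTime q z| ≤ 1 * chiTime q z := fun z => by
    rw [one_mul, abs_of_nonneg (zero_le_one.trans (hτ z))]
  have h2 : (2 : ℝ) ^ q * (1 / 2) ^ q = 1 := by rw [← mul_pow]; norm_num
  refine ⟨(((hm.mul hτ hX).summable_self hτ hη).mul_left (2 ^ q)).congr fun z => ?_,
    ((((hm.mul hτ hX).mul hτ hτ0).summable_self hτ hη).mul_left (2 ^ q)).congr fun z => ?_,
    ((((hm.mul hτ hX).mul hτ hX).summable_self hτ hη).mul_left (2 ^ q)).congr fun z => ?_⟩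
  · rw [chiProb_mul_eq, lamTerm, ← mul_assoc, h2, one_mul]
  · rw [mul_assoc (chiProb q z), chiProb_mul_eq, kappaTerm, ← mul_assoc, h2, one_mul, chiTime]
    ring
  · rw [mul_assoc (chiProb q z), chiProb_mul_eq, muTerm, ← mul_assoc, h2, one_mul]
    ring

end LogEntrySum

/-! ### The main theorem -/

theorem mainTheorem1 {m : ℕ} [NeZero m]
    (N : Seminorm ℝ (Matrix (Fin m) (Fin m) ℝ)) (hN : ∀ A, N A = 0 → A = 0)
    (D : Fin 2 → Matrix (Fin m) (Fin m) ℝ) (hD : ∀ a i j, 0 ≤ D a i j)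
    (hD_ne : ∀ z : List (Fin 2), wordProd D z ≠ 0)
    (q : ℕ) (hq : 1 ≤ q)
    (Q : Matrix (Fin m) (Fin m) ℝ) (hQ : IsUnit Q)
    (hQD : Q⁻¹ * D 0 ^ q * Q = Matrix.single 0 0 1) :
    (Summable (fun z : chi q => lamTerm Q D z) ∧
      Summable (fun z : chi q => kappaTerm Q D q z) ∧
      Summable (fun z : chi q => muTerm Q D z)) ∧
    ∃ L : ℝ → ℝ, IsMomentLyapunovExponent N D L ∧
      (∀ᶠ t in 𝓝 (0 : ℝ), DifferentiableAt ℝ L t) ∧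
      HasDerivAt L (lam Q D q) 0 ∧
      HasDerivAt (deriv L)
        ((1 + 2 * ((2 ^ (2 * q + 1) - (3 + (q : ℝ)) * 2 ^ q + 1) / (2 ^ q - 1))) * lam Q D q ^ 2
          - 2 * lam Q D q * kappa Q D q + mu Q D q) 0 := by
  obtain ⟨R, hR, hA⟩ := exists_abs_log_entrySum_le hD hD_ne
  obtain ⟨η, hη, hs, hm⟩ := exists_hasTiltedMoments_chi q
  set A : List (Fin 2) → ℝ := fun w => Real.log (entrySum (wordProd D w)) with hAdef
  have hq1 : (1 : ℝ) ≤ q := by exact_mod_cast hq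
  -- One constant for all growth bounds: the factor `q + 1` pays for a prefixed `0^q`, and 5
  -- suffices because `3 q + 2 ≤ 5 q`.
  set K : ℝ := 5 * R * (q + 1) with hKdef
  have hK : 0 ≤ K := by positivity
  have hA' : ∀ w, |A w| ≤ K * (w.length + 1) := by
    intro w
    refine (hA w).trans (mul_le_mul_of_nonneg_right ?_ (by positivity))
    nlinarith
  have hG : ∀ w, |A (List.replicate q 0 ++ w)| ≤ K * (w.length + 1) := by
    intro w
    refine (hA _).trans ?_
    simp only [List.length_append, List.length_replicate]
    push_cast
    have : (0 : ℝ) ≤ w.length := Nat.cast_nonneg _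
    have h2 : (q : ℝ) + w.length + 1 ≤ 5 * (q + 1) * (w.length + 1) := by nlinarith
    calc R * ((q : ℝ) + w.length + 1) ≤ R * (5 * (q + 1) * (w.length + 1)) := by gcongr
      _ = _ := by rw [hKdef]; ring
  have hGX : ∀ (z : chi q) y,
      A (List.replicate q 0 ++ ((z : List (Fin 2)) ++ (List.replicate q 0 ++ y))) =
        logCorner Q D z + A (List.replicate q 0 ++ y) :=
    fun z y => log_entrySum_zeros_append hD_ne hQ hQD z y
  have hAH : ∀ (z : chi q) y, A ((z : List (Fin 2)) ++ (List.replicate q 0 ++ y)) =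
      (A ((z : List (Fin 2)) ++ List.replicate q 0) - A (List.replicate q 0)) +
        A (List.replicate q 0 ++ y) :=
    fun z y => log_entrySum_append_zeros_append hD_ne hQ hQD z y
  have hbound : ∀ (z : chi q) (x : List (Fin 2)),
      (x.length : ℝ) ≤ (z : List (Fin 2)).length + 2 * q →
        |A x - A (List.replicate q 0)| ≤ K * chiTime q z := by
    intro z x hx
    have h1 := hA x
    have h2 := hA (List.replicate q 0)
    rw [List.length_replicate] at h2
    have hz : (0 : ℝ) ≤ (z : List (Fin 2)).length := Nat.cast_nonneg _
    calc |A x - A (List.replicate q 0)| ≤ |A x| + |A (List.replicate q 0)| := abs_sub _ _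
      _ ≤ R * (x.length + 1) + R * (q + 1) := add_le_add h1 h2
      _ = R * (x.length + q + 2) := by ring
      _ ≤ R * (5 * (q + 1) * chiTime q z) := by
        gcongr
        rw [chiTime]
        nlinarith
      _ = _ := by rw [hKdef]; ring
  have hX : ∀ z : chi q, |logCorner Q D z| ≤ K * chiTime q z := by
    intro z
    -- With `y` empty, `logCorner` is a difference of two values of `A`, so its linear growth
    -- follows from that of `A`.
    have h := hGX z []
    rw [List.append_nil] at h
    rw [eq_sub_of_add_eq h.symm]
    refine hbound z _ (le_of_eq ?_)
    simp only [List.length_append, List.length_replicate]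
    push_cast
    ring
  have hH : ∀ z : chi q, |A ((z : List (Fin 2)) ++ List.replicate q 0) - A (List.replicate q 0)| ≤
      K * chiTime q z := by
    intro z
    refine hbound z _ ?_
    simp only [List.length_append, List.length_replicate]
    push_cast
    linarith
  refine ⟨summable_terms hq hη.le hm hX, ?_⟩
  have hsub : ∀ x y, A (x ++ y) ≤ A x + A y := by
    intro x y
    simp only [hAdef]
    rw [← Real.log_mul (entrySum_pos (hD_ne _)).ne' (entrySum_pos (hD_ne _)).ne', wordProd_append]
    refine Real.log_le_log ?_ (entrySum_mul_le _ _)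
    rw [← wordProd_append]
    exact entrySum_pos (hD_ne _)
  choose L hL using exists_tendsto_log_wordMoment hsub hA
  obtain ⟨hm0, hm1, hm2⟩ := moments_chi hq
  obtain ⟨Λ, hΛ0, hΛc, hΛ1, hΛd, hΛ', hΛ''⟩ := exists_pressure (fun z => (chiProb_pos z).le) hm0 hm
    (one_le_chiTime hq) hX hK hη
  have hLΛ : ∀ᶠ t in 𝓝 (0 : ℝ), L t = Λ t := by
    have hc : ContinuousAt (fun t => (K + 1) * ‖(t, Λ t)‖) 0 :=
      continuousAt_const.mul (continuousAt_id.prodMk hΛc).norm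
    have h0 : (K + 1) * ‖((0 : ℝ), Λ 0)‖ < η := by simpa [hΛ0] using hη
    filter_upwards [hc.eventually_lt_const h0, hΛ1] with t ht h1
    exact exponent_eq_of_tiltSum_eq_one (G := fun y => A (List.replicate q 0 ++ y)) hq hs hm hK hA'
      hG hX hH hAH hGX (hL t) ht h1
  refine ⟨L, isMomentLyapunovExponent_of_entrySum hN hD_ne hL, ?_, ?_, ?_⟩
  · filter_upwards [hLΛ.eventually_nhds, hΛd] with t h1 h2
    exact h2.congr_of_eventuallyEq h1
  · rw [hm1, ← lam_eq] at hΛ'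
    exact hΛ'.congr_of_eventuallyEq hLΛ
  · rw [hm1, hm2, ← lam_eq] at hΛ''
    have h2q : (2 : ℝ) ^ q - 1 ≠ 0 := by
      have : (2 : ℝ) ^ 1 ≤ 2 ^ q := pow_le_pow_right₀ (by norm_num) hq
      intro h
      linarith
    -- The coefficient of `λ²` is `E τ² / E τ`, which the moment formulas turn into the stated
    -- expression.
    refine (hΛ''.congr_of_eventuallyEq (EventuallyEq.deriv hLΛ)).congr_deriv ?_
    rw [kappa_eq, mu_eq]
    field_simp
    ring
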